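/- **The model.** Let $\mathcal T$ be a finite rooted tree with levels $0,\dots,L-1$: the root $0$ is the only vertex of level $0$, every other vertex $\mathbf i$ has a parent $p(\mathbf i)$ one level above it, and all leaves are on level $L-1$. Write $c(\mathbf i)$ for the set of children and $l(\mathbf i)$ for the level of $\mathbf i$. Let $\gamma_0,\dots,\gamma_{L-1}>0$ and let $H$ be a probability distribution on a measurable parameter space $\Theta$; each parameter $t\in\Theta$ determines, measurably, a probability vector $F(t)\in\mathbb R^d$ (a word distribution; for instance $\Theta$ is the probability simplex and $F(t)=t$). In the $L$-level hierarchical Dirichlet process (HDP), $G_0\sim\mathrm{DP}(\gamma_0,H)$ and, going down the tree, $G_{\mathbf i}\sim\mathrm{DP}(\gamma_{l(\mathbf i)},G_{p(\mathbf i)})$, independently over the vertices of a level given the levels above. At every leaf $\mathbf i$ there are at least three observations $x_{\mathbf i s}\in\{e_1,\dots,e_d\}\subset\mathbb R^d$: given all $G$'s, $\theta_{\mathbf i s}\sim G_{\mathbf i}$ independently, and given these, $x_{\mathbf i s}\sim\mathrm{Categorical}(F(\theta_{\mathbf i s}))$ independently. Let almost surely $G_{\mathbf i}=\sum_{v}\pi_{\mathbf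 i v}\delta_{\phi_v}$ be a stick-breaking form of the node distributions, with countably (finitely or infinitely) many atoms $\phi_v$ shared by all vertices and weights $\pi_{\mathbf i v}\ge 0$. The topic matrix $\Phi$ has the columns $F(\phi_v)$. **Moments.** For $r=1,2,3$ the moment at a vertex $\mathbf i$ is a random tensor depending on $G_{\mathbf i}$: $$M_r^{\mathbf i}=\mathbb E\Big[\bigotimes_{s=1}^r x_{\mathbf i s}\,\Big|\,G_{\mathbf i}\Big]\ \text{ at a leaf},\qquad M_r^{\mathbf i}=\mathbb E\Big[\frac1{|c(\mathbf i)|}\sum_{\mathbf j\in c(\mathbf i)}M_r^{\mathbf j}\,\Big|\,G_{\mathbf i}\Big]\ \text{ otherwise.}$$ **Coefficients.** Put $C_2^{(L-1)}=C_4^{(L-1)}=1$, $C_3^{(L-1)}=C_5^{(L-1)}=C_6^{(L-1)}=0$ and, for $0\le l<L-1$, $$C_2^{(l)}=\frac{\gamma_{l+1}}{\gamma_{l+1}+1}C_2^{(l+1)},\quad C_3^{(l)}=C_3^{(l+1)}+\frac{C_2^{(l)}}{\gamma_{l+1}},\quad C_4^{(l)}=\frac{\gamma_{l+1}^2}{(\gamma_{l+1}+1)(\gamma_{l+1}+2)}C_4^{(l+1)},$$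 $$C_5^{(l)}=\frac{\gamma_{l+1}}{\gamma_{l+1}+1}\frac{C_3^{(l+1)}}{C_3^{(l)}}C_5^{(l+1)}+\frac{C_4^{(l)}}{\gamma_{l+1}C_3^{(l)}},\quad C_6^{(l)}=C_6^{(l+1)}+\frac{3C_5^{(l)}C_3^{(l)}}{\gamma_{l+1}}-\frac{C_4^{(l)}}{\gamma_{l+1}^2}.$$ **Notation.** $T(M,\Phi,\dots,\Phi)_{i_1\dots i_r}=\sum_{j_1,\dots,j_r}M_{j_1\dots j_r}\Phi_{i_1j_1}\cdots\Phi_{i_rj_r}$; $\mathrm{diag}(\pi)$ is the diagonal tensor (of the order required) with diagonal $\pi$; $\mathfrak S_3[A]_{ijk}=A_{ijk}+A_{jki}+A_{kij}$. **Claim.** For every vertex $\mathbf i$, with $l=l(\mathbf i)$, almost surely $$S_1^{\mathbf i}:=M_1^{\mathbf i}=T(\pi_{\mathbf i},\Phi)=\Phi\pi_{\mathbf i},\qquad S_2^{\mathbf i}:=M_2^{\mathbf i}-C_2^{(l)}S_1^{\mathbf i}\otimes S_1^{\mathbf i}=T(C_3^{(l)}\mathrm{diag}(\pi_{\mathbf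 i}),\Phi,\Phi),$$ $$S_3^{\mathbf i}:=M_3^{\mathbf i}-C_4^{(l)}S_1^{\mathbf i}\otimes S_1^{\mathbf i}\otimes S_1^{\mathbf i}-C_5^{(l)}\mathfrak S_3[S_2^{\mathbf i}\otimes M_1^{\mathbf i}]=T(C_6^{(l)}\mathrm{diag}(\pi_{\mathbf i}),\Phi,\Phi,\Phi).$$ Moreover $C_3^{(l)}>0$ for $l<L-1$, and at the root the coefficients $C_k=C_k^{(0)}$ are $$C_2=\frac{\prod_{i=1}^{L-1}\gamma_i}{\prod_{i=1}^{L-1}(\gamma_i+1)},\quad C_3=\sum_{i=1}^{L-1}\frac{\prod_{j=1}^{i-1}\gamma_{L-j}}{\prod_{j=1}^{i}(\gamma_{L-j}+1)},\quad C_4=\frac{\prod_{i=1}^{L-1}\gamma_i^2}{\prod_{i=1}^{L-1}(\gamma_i+1)(\gamma_i+2)},$$ $$C_5=\frac1{C_3}\sum_{i=1}^{L-1}\frac{\prod_{j=1}^{i-1}\gamma_{L-j}\prod_{j=1}^{L-1}\gamma_j}{\prod_{j=1}^{i}(\gamma_{L-j}+2)\prod_{j=1}^{L-1}(\gamma_j+1)}\quad(L\ge2),$$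 $$C_6=3\sum_{i=1}^{L-2}\sum_{j=i+1}^{L-1}\frac{\prod_{k=1}^{i-1}\gamma_{L-k}\prod_{k=1}^{j-1}\gamma_{L-k}}{\prod_{k=1}^{i}(\gamma_{L-k}+2)\prod_{k=1}^{j}(\gamma_{L-k}+1)}+2\sum_{i=1}^{L-1}\frac{\prod_{j=1}^{i-1}\gamma_{L-j}^2}{\prod_{j=1}^{i}(\gamma_{L-j}+1)(\gamma_{L-j}+2)}.$$ -/

import Mathlib

open MeasureTheory ProbabilityTheory

noncomputable section

namespace HDP

/-! ### Rooted trees of depth `L` -/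

/-- A rooted tree with vertex set `V` and levels `0, …, L - 1`: the root is the only vertex of
level `0`, every other vertex lies one level below its parent, and every vertex above the bottom
level `L - 1` has a child.  (The value `parent root` carries no information.) -/
structure LevelTree (V : Type*) (L : ℕ) where
  root : V
  parent : V → V
  level : V → ℕ
  level_lt : ∀ v, level v < L
  level_eq_zero_iff : ∀ v, level v = 0 ↔ v = root
  level_parent : ∀ v, v ≠ root → level v = level (parent v) + 1
  exists_child : ∀ v, level v + 1 < L → ∃ w, w ≠ root ∧ parent w = v

namespace LevelTree

variable {V : Type*} {L : ℕ}

/-- The set `c(i)` of children of the vertex `i`. -/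
def children [Fintype V] [DecidableEq V] (T : LevelTree V L) (i : V) : Finset V :=
  Finset.univ.filter fun j => j ≠ T.root ∧ T.parent j = i

/-- The leaves are the vertices of the bottom level `L - 1`. -/
def IsLeaf (T : LevelTree V L) (i : V) : Prop := T.level i + 1 = L

end LevelTree

/-! ### Dirichlet distributions and Dirichlet processes -/

/-- The gamma distribution with shape `a` and unit rate; for shape `0` it is the point mass
at `0`. -/
def gammaLaw (a : ℝ) : Measure ℝ := if 0 < a then gammaMeasure a 1 else Measure.dirac 0

/-- The Dirichlet distribution with parameters `α i ≥ 0`, not all zero: the law of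
`(g i / ∑ j, g j)` for independent `g i` with law `Gamma (α i, 1)`. -/
def dirichlet {ι : Type*} [Fintype ι] (α : ι → ℝ) : Measure (ι → ℝ) :=
  (Measure.pi fun i => gammaLaw (α i)).map fun g i => g i / ∑ j, g j

/-- A finite measurable partition of `Θ`. -/
def IsPartition {Θ : Type*} [MeasurableSpace Θ] {n : ℕ} (A : Fin n → Set Θ) : Prop :=
  (∀ k, MeasurableSet (A k)) ∧ Pairwise (fun k l => Disjoint (A k) (A l)) ∧ ⋃ k, A k = Set.univ

/-- Given the sub-σ-algebra `m`, the random measure `G` is a Dirichlet process with concentration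
`γ` and (possibly random, `m`-measurable) base measure `G₀`: for every finite measurable partition
`A` of `Θ`, the conditional law given `m` of the vector of masses `G (A k)` is the Dirichlet
distribution with parameters `γ * G₀ (A k)`. -/
def CondDirichletProcess {Ω Θ : Type*} [MeasurableSpace Θ] {mΩ : MeasurableSpace Ω}
    (μ : Measure Ω) (m : MeasurableSpace Ω) (γ : ℝ) (G₀ G : Ω → Measure Θ) : Prop :=
  ∀ (n : ℕ) (A : Fin n → Set Θ), IsPartition A → ∀ B : Set (Fin n → ℝ), MeasurableSet B →
    μ[((fun ω k => (G ω).real (A k)) ⁻¹' B).indicator (fun _ => (1 : ℝ)) | m]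
      =ᵐ[μ] fun ω => (dirichlet fun k => γ * (G₀ ω).real (A k)).real B

/-! ### The hierarchical Dirichlet process -/

section Model

variable {Ω Θ V : Type*} [MeasurableSpace Θ] {L d : ℕ}

/-- The indices `(i, s)` of the observations: `s < N i` at a leaf `i`. -/
def Token (T : LevelTree V L) (N : V → ℕ) : Set (V × ℕ) := {p | T.IsLeaf p.1 ∧ p.2 < N p.1}

/-- The σ-algebra generated by all `G k` with `k ≠ i` whose level is at most that of `i`. -/
abbrev pastOfNode (T : LevelTree V L) (G : V → Ω → Measure Θ) (i : V) : MeasurableSpace Ω :=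
  ⨆ k ∈ {k : V | k ≠ i ∧ T.level k ≤ T.level i}, MeasurableSpace.comap (G k) inferInstance

/-- The σ-algebra generated by all `G k` and the topics of all tokens other than `p`. -/
abbrev pastOfTopic (T : LevelTree V L) (N : V → ℕ) (G : V → Ω → Measure Θ) (θ : V → ℕ → Ω → Θ)
    (p : V × ℕ) : MeasurableSpace Ω :=
  (⨆ k : V, MeasurableSpace.comap (G k) inferInstance) ⊔
    ⨆ q ∈ Token T N \ {p}, MeasurableSpace.comap (θ q.1 q.2) inferInstance

/-- The σ-algebra generated by all `G k`, the topics of all tokens, and all observed words other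
than the word of the token `p`. -/
abbrev pastOfWord (T : LevelTree V L) (N : V → ℕ) (G : V → Ω → Measure Θ) (θ : V → ℕ → Ω → Θ)
    (x : V → ℕ → Ω → Fin d) (p : V × ℕ) : MeasurableSpace Ω :=
  (⨆ k : V, MeasurableSpace.comap (G k) inferInstance) ⊔
    (⨆ q ∈ Token T N, MeasurableSpace.comap (θ q.1 q.2) inferInstance) ⊔
      ⨆ q ∈ Token T N \ {p}, MeasurableSpace.comap (x q.1 q.2) inferInstance

/-- The `L`-level hierarchical Dirichlet process on the tree `T`, with concentration `γ l` at
level `l`, base distribution `H` on the parameter space `Θ`, word distribution `F t` over the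
vocabulary `Fin d` for each parameter `t`, and `N i` words at each leaf `i`:

* `G root ∼ DP(γ 0, H)`, and `G i ∼ DP(γ (level i), G (parent i))` for every other vertex `i`,
  conditionally on the other vertices down to the level of `i`;
* `θ i s ∼ G i` at every leaf `i`, conditionally on all `G k` and on the other topics;
* `x i s ∼ Categorical (F (θ i s))`, conditionally on all `G k`, all topics and the other words. -/
structure IsHDP {mΩ : MeasurableSpace Ω} (μ : Measure Ω) (T : LevelTree V L) (γ : ℕ → ℝ)
    (H : Measure Θ) (F : Θ → Fin d → ℝ) (N : V → ℕ)
    (G : V → Ω → Measure Θ) (θ : V → ℕ → Ω → Θ) (x : V → ℕ → Ω → Fin d) : Prop where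
  measurable_F : Measurable F
  F_nonneg : ∀ t a, 0 ≤ F t a
  F_sum : ∀ t, ∑ a, F t a = 1
  measurable_G : ∀ i, Measurable (G i)
  isProbabilityMeasure_G : ∀ i ω, IsProbabilityMeasure (G i ω)
  measurable_θ : ∀ i s, Measurable (θ i s)
  measurable_x : ∀ i s, Measurable (x i s)
  law_root : CondDirichletProcess μ (pastOfNode T G T.root) (γ 0) (fun _ => H) (G T.root)
  law_node : ∀ i, i ≠ T.root →
    CondDirichletProcess μ (pastOfNode T G i) (γ (T.level i)) (G (T.parent i)) (G i)
  law_topic : ∀ i s, (i, s) ∈ Token T N → ∀ B : Set Θ, MeasurableSet B →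
    μ[(θ i s ⁻¹' B).indicator (fun _ => (1 : ℝ)) | pastOfTopic T N G θ (i, s)]
      =ᵐ[μ] fun ω => (G i ω).real B
  law_word : ∀ i s, (i, s) ∈ Token T N → ∀ a : Fin d,
    μ[(x i s ⁻¹' {a}).indicator (fun _ => (1 : ℝ)) | pastOfWord T N G θ x (i, s)]
      =ᵐ[μ] fun ω => F (θ i s ω) a

/-- The stick-breaking form `G i = ∑ v, π i v δ_(φ v)` of the node distributions, almost surely,
with nonnegative weights and with atoms `φ v` that are shared by all vertices. -/
def IsStickBreaking {κ : Type*} {mΩ : MeasurableSpace Ω} (μ : Measure Ω) (G : V → Ω → Measure Θ)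
    (π : V → Ω → κ → ℝ) (φ : Ω → κ → Θ) : Prop :=
  (∀ i ω v, 0 ≤ π i ω v) ∧
    ∀ i, ∀ᵐ ω ∂μ, G i ω = Measure.sum fun v => ENNReal.ofReal (π i ω v) • Measure.dirac (φ ω v)

/-- The topic matrix: the column of the topic `v` is the word distribution of the atom `φ v`. -/
def topicMatrix {κ : Type*} (F : Θ → Fin d → ℝ) (φ : κ → Θ) : Matrix (Fin d) κ ℝ :=
  Matrix.of fun a v => F (φ v) a

end Model

/-! ### Tensors -/

/-- Real tensors of order `r` with indices in `ι`. -/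
abbrev Tensor (ι : Type*) (r : ℕ) : Type _ := (Fin r → ι) → ℝ

/-- `T(M, Φ, …, Φ)` for a tensor `M` of order `r`. -/
def tensorMap {ι κ : Type*} {r : ℕ} (M : Tensor κ r) (Φ : Matrix ι κ ℝ) : Tensor ι r :=
  fun a => ∑' j : Fin r → κ, M j * ∏ s, Φ (a s) (j s)

/-- The diagonal tensor of order `r + 1` with diagonal `w`; for order one it is the vector `w`. -/
def diagTensor {κ : Type*} [DecidableEq κ] (r : ℕ) (w : κ → ℝ) : Tensor κ (r + 1) :=
  fun j => if ∀ s, j s = j 0 then w (j 0) else 0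

/-- The tensor product. -/
def outer {ι : Type*} {m n : ℕ} (A : Tensor ι m) (B : Tensor ι n) : Tensor ι (m + n) :=
  fun a => A (fun s => a (Fin.castAdd n s)) * B (fun s => a (Fin.natAdd m s))

/-- `𝔖₃[A]_{ijk} = A_{ijk} + A_{jki} + A_{kij}`. -/
def sym3 {ι : Type*} (A : Tensor ι 3) : Tensor ι 3 :=
  fun a => A ![a 0, a 1, a 2] + A ![a 1, a 2, a 0] + A ![a 2, a 0, a 1]

/-! ### Moments and symmetric tensors at the vertices -/

section Moments

variable {Ω Θ V : Type*} [MeasurableSpace Θ] {L d : ℕ} [Fintype V] [DecidableEq V]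

/-- The binary encoding `e_w` of a word `w`. -/
def oneHot (w : Fin d) : Fin d → ℝ := Pi.single w 1

/-- The order `r` moment at the vertex `i`, which lies `h` levels above the bottom level, as a
random tensor that is measurable with respect to `G i`. At a leaf it is the conditional expectation
given `G i` of the tensor product of `r` observations; above, it is the average over the children
of their moments, integrated over the children's distributions given `G i`. -/
def momentAtHeight {mΩ : MeasurableSpace Ω} (μ : Measure Ω) (T : LevelTree V L)
    (G : V → Ω → Measure Θ) (x : V → ℕ → Ω → Fin d) (r : ℕ) :
    ℕ → V → Ω → Tensor (Fin d) r
  | 0, i => fun ω a =>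
      (μ[fun ω' => ∏ s : Fin r, oneHot (x i s ω') (a s) |
        MeasurableSpace.comap (G i) inferInstance]) ω
  | h + 1, i => fun ω a =>
      (μ[fun ω' => (1 / ((T.children i).card : ℝ)) *
          ∑ j ∈ T.children i, momentAtHeight μ T G x r h j ω' a |
        MeasurableSpace.comap (G i) inferInstance]) ω

/-- The order `r` moment `M_r` at the vertex `i`. -/
def moment {mΩ : MeasurableSpace Ω} (μ : Measure Ω) (T : LevelTree V L)
    (G : V → Ω → Measure Θ) (x : V → ℕ → Ω → Fin d) (r : ℕ) (i : V) : Ω → Tensor (Fin d) r :=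
  momentAtHeight μ T G x r (L - 1 - T.level i) i

end Moments

/-! ### The coefficients, by recursion from the bottom level `L - 1` upwards -/

/-- `C₂` at level `l`. -/
def C2 (γ : ℕ → ℝ) (L l : ℕ) : ℝ :=
  if l + 1 < L then γ (l + 1) / (γ (l + 1) + 1) * C2 γ L (l + 1) else 1
termination_by L - l

/-- `C₃` at level `l`. -/
def C3 (γ : ℕ → ℝ) (L l : ℕ) : ℝ :=
  if l + 1 < L then C3 γ L (l + 1) + C2 γ L l / γ (l + 1) else 0
termination_by L - l

/-- `C₄` at level `l`. -/
def C4 (γ : ℕ → ℝ) (L l : ℕ) : ℝ :=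
  if l + 1 < L then
    γ (l + 1) ^ 2 / ((γ (l + 1) + 1) * (γ (l + 1) + 2)) * C4 γ L (l + 1)
  else 1
termination_by L - l

/-- `C₅` at level `l`. -/
def C5 (γ : ℕ → ℝ) (L l : ℕ) : ℝ :=
  if l + 1 < L then
    γ (l + 1) / (γ (l + 1) + 1) * (C3 γ L (l + 1) / C3 γ L l) * C5 γ L (l + 1) +
      1 / (γ (l + 1) * C3 γ L l) * C4 γ L l
  else 0
termination_by L - l

/-- `C₆` at level `l`. -/
def C6 (γ : ℕ → ℝ) (L l : ℕ) : ℝ :=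
  if l + 1 < L then
    C6 γ L (l + 1) + 3 * (C5 γ L l * C3 γ L l / γ (l + 1)) - C4 γ L l / γ (l + 1) ^ 2
  else 0
termination_by L - l

/-! ### The symmetric tensors -/

section SymmetricTensors

variable {Ω Θ V : Type*} [MeasurableSpace Θ] {L d : ℕ} [Fintype V] [DecidableEq V]

/-- `S₁ = M₁`. -/
def S1 {mΩ : MeasurableSpace Ω} (μ : Measure Ω) (T : LevelTree V L)
    (G : V → Ω → Measure Θ) (x : V → ℕ → Ω → Fin d) (i : V) (ω : Ω) : Tensor (Fin d) 1 :=
  moment μ T G x 1 i ω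

/-- `S₂ = M₂ - C₂ S₁ ⊗ S₁`. -/
def S2 {mΩ : MeasurableSpace Ω} (μ : Measure Ω) (T : LevelTree V L) (γ : ℕ → ℝ)
    (G : V → Ω → Measure Θ) (x : V → ℕ → Ω → Fin d) (i : V) (ω : Ω) : Tensor (Fin d) 2 :=
  moment μ T G x 2 i ω - C2 γ L (T.level i) • outer (S1 μ T G x i ω) (S1 μ T G x i ω)

/-- `S₃ = M₃ - C₄ S₁ ⊗ S₁ ⊗ S₁ - C₅ 𝔖₃[S₂ ⊗ M₁]`. -/
def S3 {mΩ : MeasurableSpace Ω} (μ : Measure Ω) (T : LevelTree V L) (γ : ℕ → ℝ)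
    (G : V → Ω → Measure Θ) (x : V → ℕ → Ω → Fin d) (i : V) (ω : Ω) : Tensor (Fin d) 3 :=
  moment μ T G x 3 i ω
    - C4 γ L (T.level i) •
        outer (outer (S1 μ T G x i ω) (S1 μ T G x i ω)) (S1 μ T G x i ω)
    - C5 γ L (T.level i) • sym3 (outer (S2 μ T γ G x i ω) (moment μ T G x 1 i ω))

end SymmetricTensors

end HDP

end

open MeasureTheory ProbabilityTheory

noncomputable section

namespace HDP

/-! ### Third moments of the Dirichlet distribution -/

/-! The moment of each order at a vertex is a fixed functional of its node distribution `G i`: a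
combination of products of integrals of coordinates `f`, `g`, `k` of `F`. For order three it is `C4
∫f ∫g ∫k + C5 C3 (∫fg ∫k + ∫fk ∫g + ∫gk ∫f) + C6 ∫fgk`; for order two, `C2 ∫f ∫g + C3 ∫fg`; for
order one, `∫f`.

At a leaf, conditional independence gives the plain product of integrals (`condExp_prod_oneHot`).
One level up, the functional of a child is averaged given the parent by the moments of a Dirichlet
process, which again yields integrals of the same shape; the recursion for the coefficients is
exactly the resulting comparison of coefficients (`hasCondExp_momentFunctional2`,
`hasCondExp_momentFunctional3`). All children of a vertex give the same value, so averaging over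
them changes nothing (`moment_ae_eq`). Subtracting the product terms leaves `C3 ∫fg` and `C6 ∫fgk`,
and an integral against a sum of point masses is a diagonal tensor mapped by the topic matrix.

The analytic input is the third moment of a Dirichlet process; second and first moments follow by
inserting the constant function 1. For simple functions it is a Dirichlet moment, and bounded
approximation gives the rest. Dirichlet moments come from gamma variables through `1 / s ^ 3 = ∫ t ^
2 / 2 * exp (-t s) dt`, which decouples the coordinates and also covers vanishing parameters.

The closed forms are inductions on the height above the bottom level. There and in the functionals
only the product `C5 * C3` occurs, so the division by `C3` disappears. -/

/-- The rising factorial `a (a + 1) ⋯ (a + n - 1)`. -/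
def rising (a : ℝ) (n : ℕ) : ℝ := ∏ k ∈ Finset.range n, (a + k)

theorem rising_succ (a : ℝ) (n : ℕ) : rising a (n + 1) = rising a n * (a + n) :=
  Finset.prod_range_succ _ _

theorem rising_nonneg {a : ℝ} (ha : 0 ≤ a) (n : ℕ) : 0 ≤ rising a n :=
  Finset.prod_nonneg fun k _ => by positivity

theorem Gamma_add_natCast {a : ℝ} (ha : 0 < a) (n : ℕ) :
    Real.Gamma (a + n) = rising a n * Real.Gamma a := by
  induction n with
  | zero => simp [rising]
  | succ n ih =>
    rw [Nat.cast_succ, ← add_assoc, Real.Gamma_add_one (by positivity), ih, rising_succ]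
    ring

instance isProbabilityMeasure_gammaLaw (a : ℝ) : IsProbabilityMeasure (gammaLaw a) := by
  unfold gammaLaw
  split_ifs with h
  · exact isProbabilityMeasure_gammaMeasure h one_pos
  · infer_instance

theorem gammaLaw_ae_nonneg (a : ℝ) : ∀ᵐ g ∂gammaLaw a, 0 ≤ g := by
  unfold gammaLaw
  split_ifs with h
  · rw [gammaMeasure, ae_withDensity_iff (by unfold gammaPDF; fun_prop)]
    refine ae_of_all _ fun g hg => ?_
    by_contra! hn
    exact hg (gammaPDF_of_neg hn)
  · rw [ae_dirac_iff measurableSet_Ici]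

theorem gammaLaw_ae_pos {a : ℝ} (ha : 0 < a) : ∀ᵐ g ∂gammaLaw a, 0 < g := by
  have h0 : ∀ᵐ g ∂gammaLaw a, g ≠ 0 := by
    rw [gammaLaw, if_pos ha, gammaMeasure]
    exact (withDensity_absolutelyContinuous _ _).ae_le (Measure.ae_ne volume 0)
  filter_upwards [gammaLaw_ae_nonneg a, h0] with g h1 h2 using lt_of_le_of_ne h1 h2.symm

/-- The integrand against the gamma density is again a gamma density up to constants, with shape `a
+ n` and rate `1 + t`. At shape 0 the point mass agrees because `rising 0 n` vanishes for `n > 0`.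
-/
theorem integral_gammaLaw_pow_mul_exp {a t : ℝ} (ha : 0 ≤ a) (ht : 0 < t) (n : ℕ) :
    ∫ g, g ^ n * Real.exp (-(t * g)) ∂gammaLaw a = rising a n * (1 / (1 + t)) ^ (a + n) := by
  rcases ha.eq_or_lt with rfl | ha
  · rw [gammaLaw, if_neg (lt_irrefl _), integral_dirac]
    cases n with
    | zero => simp [rising]
    | succ n => simp [rising, Finset.prod_range_succ']
  · rw [gammaLaw, if_pos ha, gammaMeasure,
      integral_withDensity_eq_integral_toReal_smul (by unfold gammaPDF; fun_prop)
        (by simp [gammaPDF])]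
    have h1 : ∀ g : ℝ, (gammaPDF a 1 g).toReal • (g ^ n * Real.exp (-(t * g))) =
        (Set.Ici 0).indicator (fun g => (Real.Gamma a)⁻¹ *
          (g ^ (a - 1) * g ^ n * Real.exp (-((1 + t) * g)))) g := by
      intro g
      by_cases hg : 0 ≤ g
      · rw [Set.indicator_of_mem (show g ∈ Set.Ici 0 from hg), gammaPDF_of_nonneg hg,
          ENNReal.toReal_ofReal (by have := Real.Gamma_pos_of_pos ha; positivity)]
        have : Real.exp (-((1 + t) * g)) = Real.exp (-(1 * g)) * Real.exp (-(t * g)) := by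
          rw [← Real.exp_add]; ring_nf
        rw [this, Real.one_rpow, smul_eq_mul]
        ring
      · rw [Set.indicator_of_notMem (show g ∉ Set.Ici 0 from hg), gammaPDF_of_neg (by linarith)]
        simp
    rw [integral_congr_ae (ae_of_all _ h1), integral_indicator measurableSet_Ici,
      integral_Ici_eq_integral_Ioi, integral_const_mul]
    have h2 : ∫ g in Set.Ioi (0 : ℝ), g ^ (a - 1) * g ^ n * Real.exp (-((1 + t) * g)) =
        ∫ g in Set.Ioi (0 : ℝ), g ^ (a + n - 1) * Real.exp (-((1 + t) * g)) := by
      refine setIntegral_congr_fun measurableSet_Ioi fun g hg => ?_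
      rw [← Real.rpow_natCast, ← Real.rpow_add hg]
      ring_nf
    rw [h2, Real.integral_rpow_mul_exp_neg_mul_Ioi (by positivity) (by positivity),
      Gamma_add_natCast ha]
    have := (Real.Gamma_pos_of_pos ha).ne'
    field_simp

theorem integrable_gammaLaw_pow_mul_exp {t : ℝ} (a : ℝ) (ht : 0 < t) (n : ℕ) :
    Integrable (fun g => g ^ n * Real.exp (-(t * g))) (gammaLaw a) := by
  refine Integrable.of_bound (C := n.factorial / t ^ n) (by fun_prop) ?_
  -- The bound `n! / t ^ n` comes from `x ^ n / n! ≤ exp x` at `x = t g`.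
  filter_upwards [gammaLaw_ae_nonneg a] with g hg
  have h := Real.pow_div_factorial_le_exp (t * g) (by positivity) n
  rw [Real.norm_of_nonneg (by positivity), Real.exp_neg, ← div_eq_mul_inv,
    div_le_div_iff₀ (Real.exp_pos _) (by positivity), ← mul_pow, mul_comm g]
  rwa [div_le_iff₀' (by positivity)] at h

section

variable {ι : Type*} [Fintype ι]

/-- Independence factors the integral. The dependence on `t` is only through the total shape and the
total degree, which is what makes a common constant possible for all monomials of one degree. -/
theorem lintegral_pi_gammaLaw_prod {α : ι → ℝ} (hα : ∀ i, 0 ≤ α i) {t : ℝ} (ht : 0 < t)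
    (n : ι → ℕ) :
    ∫⁻ g : ι → ℝ, ENNReal.ofReal ((∏ i, g i ^ n i) * Real.exp (-(t * ∑ i, g i)))
        ∂Measure.pi (fun i => gammaLaw (α i)) =
      ENNReal.ofReal ((∏ i, rising (α i) (n i)) * (1 / (1 + t)) ^ (∑ i, α i + ∑ i, (n i : ℝ))) := by
  have h : ∀ g : ι → ℝ, (∏ i, g i ^ n i) * Real.exp (-(t * ∑ i, g i)) =
      ∏ i, (g i ^ n i * Real.exp (-(t * g i))) := fun g => by
    rw [Finset.prod_mul_distrib, ← Real.exp_sum, Finset.sum_neg_distrib, Finset.mul_sum]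
  have hpos : ∀ᵐ g ∂Measure.pi (fun i => gammaLaw (α i)), ∀ i, 0 ≤ g i :=
    ae_all_iff.2 fun i => Measure.tendsto_eval_ae_ae.eventually (gammaLaw_ae_nonneg (α i))
  rw [← ofReal_integral_eq_lintegral_ofReal]
  · simp_rw [h]
    rw [integral_fintype_prod_eq_prod (fun i (x : ℝ) => x ^ n i * Real.exp (-(t * x)))]
    simp_rw [fun i => integral_gammaLaw_pow_mul_exp (hα i) ht (n i)]
    rw [Finset.prod_mul_distrib, ← Finset.sum_add_distrib, Real.rpow_sum_of_pos (by positivity)]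
  · simp_rw [h]
    exact Integrable.fintype_prod fun i => integrable_gammaLaw_pow_mul_exp (α i) ht (n i)
  · filter_upwards [hpos] with g hg
    have := Finset.prod_nonneg fun i (_ : i ∈ Finset.univ) => pow_nonneg (hg i) (n i)
    simp only [Pi.zero_apply]
    positivity

theorem ae_pi_gammaLaw {α : ι → ℝ} (h : 0 < ∑ i, α i) :
    ∀ᵐ g ∂Measure.pi (fun i => gammaLaw (α i)), (∀ i, 0 ≤ g i) ∧ 0 < ∑ i, g i := by
  have hpos : ∀ᵐ g ∂Measure.pi (fun i => gammaLaw (α i)), ∀ i, 0 ≤ g i :=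
    ae_all_iff.2 fun i => Measure.tendsto_eval_ae_ae.eventually (gammaLaw_ae_nonneg (α i))
  obtain ⟨i, hi, hαi⟩ : ∃ i ∈ Finset.univ, 0 < α i := by
    by_contra! hn
    exact h.not_ge (Finset.sum_nonpos hn)
  filter_upwards [hpos, Measure.tendsto_eval_ae_ae.eventually (gammaLaw_ae_pos hαi)] with g h1 h2
  exact ⟨h1, Finset.sum_pos' (fun j _ => h1 j) ⟨i, hi, h2⟩⟩

theorem lintegral_sq_mul_exp {s : ℝ} (hs : 0 < s) :
    ∫⁻ t in Set.Ioi (0 : ℝ), ENNReal.ofReal (t ^ 2 / 2 * Real.exp (-(t * s))) =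
      ENNReal.ofReal (1 / s ^ 3) := by
  have h := Real.integral_rpow_mul_exp_neg_mul_Ioi (a := 3) (by norm_num) hs
  have h3 : Real.Gamma 3 = 2 := by
    have := Real.Gamma_nat_eq_factorial 2
    rw [show ((2 : ℕ) : ℝ) + 1 = 3 by norm_num] at this
    rw [this]
    norm_num
  -- A nonzero Bochner integral forces integrability.
  have hne : ∫ t in Set.Ioi (0 : ℝ), t ^ ((3 : ℝ) - 1) * Real.exp (-(s * t)) ≠ 0 := by
    rw [h, h3]; positivity
  have hint := Integrable.of_integral_ne_zero hne
  have e : ∀ t : ℝ, t ^ 2 / 2 * Real.exp (-(t * s)) =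
      (1 / 2) * (t ^ ((3 : ℝ) - 1) * Real.exp (-(s * t))) := by
    intro t
    have : ((3 : ℝ) - 1) = (2 : ℕ) := by norm_num
    rw [this, Real.rpow_natCast, mul_comm t s]
    ring
  simp_rw [e]
  rw [← ofReal_integral_eq_lintegral_ofReal (hint.const_mul _), integral_const_mul, h, h3]
  · congr 1
    rw [Real.div_rpow (by norm_num) hs.le, Real.one_rpow]
    norm_cast
    ring
  · refine ae_restrict_of_forall_mem measurableSet_Ioi fun t ht => ?_
    have : (0 : ℝ) < t := ht
    simp only [Pi.zero_apply]
    positivity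

/-- Writing the inverse cube of the sum as a Laplace integral and exchanging the integrals by
Tonelli separates the coordinates. The remaining `t`-integral is the same for all cubic monomials;
its value is never computed, since normalisation determines it. -/
theorem exists_lintegral_pi_gammaLaw_prod_div {α : ι → ℝ} (hα : ∀ i, 0 ≤ α i)
    (h : 0 < ∑ i, α i) :
    ∃ c : ENNReal, ∀ n : ι → ℕ, ∑ i, n i = 3 →
      ∫⁻ g : ι → ℝ, ENNReal.ofReal ((∏ i, g i ^ n i) / (∑ i, g i) ^ 3)
        ∂Measure.pi (fun i => gammaLaw (α i)) = ENNReal.ofReal (∏ i, rising (α i) (n i)) * c := by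
  refine ⟨∫⁻ t in Set.Ioi (0 : ℝ),
    ENNReal.ofReal (t ^ 2 / 2 * (1 / (1 + t)) ^ (∑ i, α i + 3)), fun n hn => ?_⟩
  have hn' : ∑ i, (n i : ℝ) = 3 := by exact_mod_cast hn
  calc
    _ = ∫⁻ g : ι → ℝ, (∫⁻ t in Set.Ioi (0 : ℝ), ENNReal.ofReal
          (t ^ 2 / 2 * ((∏ i, g i ^ n i) * Real.exp (-(t * ∑ i, g i)))))
          ∂Measure.pi (fun i => gammaLaw (α i)) := by
      refine lintegral_congr_ae ?_
      filter_upwards [ae_pi_gammaLaw h] with g hg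
      have hp := Finset.prod_nonneg fun i (_ : i ∈ Finset.univ) => pow_nonneg (hg.1 i) (n i)
      rw [div_eq_mul_one_div, ENNReal.ofReal_mul hp, ← lintegral_sq_mul_exp hg.2,
        ← lintegral_const_mul _ (by fun_prop)]
      refine lintegral_congr fun t => ?_
      rw [← ENNReal.ofReal_mul hp]
      congr 1
      ring
    _ = ∫⁻ t in Set.Ioi (0 : ℝ), (∫⁻ g : ι → ℝ, ENNReal.ofReal
          (t ^ 2 / 2 * ((∏ i, g i ^ n i) * Real.exp (-(t * ∑ i, g i))))
          ∂Measure.pi (fun i => gammaLaw (α i))) := by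
      refine lintegral_lintegral_swap (Measurable.aemeasurable ?_)
      simp only [Function.uncurry_def]
      fun_prop
    _ = ∫⁻ t in Set.Ioi (0 : ℝ), ENNReal.ofReal (∏ i, rising (α i) (n i)) *
          ENNReal.ofReal (t ^ 2 / 2 * (1 / (1 + t)) ^ (∑ i, α i + 3)) := by
      refine setLIntegral_congr_fun measurableSet_Ioi fun t ht => ?_
      have ht : (0 : ℝ) < t := ht
      simp_rw [ENNReal.ofReal_mul (show 0 ≤ t ^ 2 / 2 by positivity)]
      rw [lintegral_const_mul _ (by fun_prop), lintegral_pi_gammaLaw_prod hα ht, hn',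
        ENNReal.ofReal_mul (Finset.prod_nonneg fun i _ => rising_nonneg (hα i) _)]
      ring
    _ = _ := lintegral_const_mul _ (by fun_prop)

theorem ae_dirichlet {α : ι → ℝ} (h : 0 < ∑ i, α i) :
    ∀ᵐ p ∂dirichlet α, (∀ i, p i ∈ Set.Icc (0 : ℝ) 1) ∧ ∑ i, p i = 1 := by
  unfold dirichlet
  rw [ae_map_iff (by fun_prop) (by measurability)]
  filter_upwards [ae_pi_gammaLaw h] with g hg
  refine ⟨fun i => ⟨div_nonneg (hg.1 i) hg.2.le, div_le_one_of_le₀ ?_ hg.2.le⟩, ?_⟩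
  · exact Finset.single_le_sum (fun j _ => hg.1 j) (Finset.mem_univ i)
  · rw [← Finset.sum_div, div_self hg.2.ne']

instance isProbabilityMeasure_dirichlet (α : ι → ℝ) : IsProbabilityMeasure (dirichlet α) :=
  Measure.isProbabilityMeasure_map (by fun_prop)

theorem integrable_dirichlet_mul_mul {α : ι → ℝ} (h : 0 < ∑ i, α i) (i j k : ι) :
    Integrable (fun p : ι → ℝ => p i * p j * p k) (dirichlet α) := by
  refine Integrable.of_bound (C := 1) (by fun_prop) ?_
  filter_upwards [ae_dirichlet h] with p hp
  rw [Real.norm_of_nonneg (mul_nonneg (mul_nonneg (hp.1 i).1 (hp.1 j).1) (hp.1 k).1)]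
  exact mul_le_one₀ (mul_le_one₀ (hp.1 i).2 (hp.1 j).1 (hp.1 j).2) (hp.1 k).1 (hp.1 k).2

variable [DecidableEq ι]

theorem prod_rising_add_single (α : ι → ℝ) (n : ι → ℕ) (k : ι) :
    ∏ i, rising (α i) ((n + Pi.single k 1 : ι → ℕ) i) = (∏ i, rising (α i) (n i)) * (α k + n k) := by
  rw [← Finset.mul_prod_erase _ _ (Finset.mem_univ k),
    ← Finset.mul_prod_erase (a := k) _ (fun i => rising (α i) (n i)) (Finset.mem_univ k)]
  have : ∏ i ∈ Finset.univ.erase k, rising (α i) ((n + Pi.single k 1 : ι → ℕ) i) =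
      ∏ i ∈ Finset.univ.erase k, rising (α i) (n i) :=
    Finset.prod_congr rfl fun i hi => by simp [Finset.ne_of_mem_erase hi]
  rw [this]
  simp only [Pi.add_apply, Pi.single_eq_same, rising_succ]
  ring

theorem prod_pow_add_single (g : ι → ℝ) (n : ι → ℕ) (k : ι) :
    ∏ i, g i ^ ((n + Pi.single k 1 : ι → ℕ) i) = (∏ i, g i ^ n i) * g k := by
  simp only [Pi.add_apply, pow_add, Finset.prod_mul_distrib]
  congr 1
  rw [Finset.prod_eq_single k (fun i _ hi => by simp [hi]) (by simp)]
  simp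

/-- The third moment `α i (α j + δ_ij) (α k + δ_ik + δ_jk)` of independent gamma variables with
shapes `α`. -/
def cubicWeight (α : ι → ℝ) (i j k : ι) : ℝ :=
  α i * (α j + if i = j then 1 else 0) * (α k + (if i = k then 1 else 0) + if j = k then 1 else 0)

/-- The five terms are the coincidence patterns of three indices: all free, one of three pairs
equal, all equal. -/
theorem sum_cubicWeight (α a b c : ι → ℝ) :
    ∑ i, ∑ j, ∑ k, a i * b j * c k * cubicWeight α i j k =
      (∑ i, a i * α i) * (∑ i, b i * α i) * (∑ i, c i * α i) +
      (∑ i, a i * b i * α i) * (∑ i, c i * α i) + (∑ i, a i * c i * α i) * (∑ i, b i * α i) +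
      (∑ i, b i * c i * α i) * (∑ i, a i * α i) + 2 * ∑ i, a i * b i * c i * α i := by
  -- Once `i = j`, the indicators of `i = k` and `j = k` agree, which produces the factor 2.
  have h : ∀ i j k, a i * b j * c k * cubicWeight α i j k =
      (a i * α i) * (b j * α j) * (c k * α k) +
      (if i = j then (a i * b i * α i) * (c k * α k) else 0) +
      (if i = k then (a i * c i * α i) * (b j * α j) else 0) +
      (if j = k then (b j * c j * α j) * (a i * α i) else 0) +
      if i = j then if i = k then 2 * (a i * b i * c i * α i) else 0 else 0 := by
    intro i j k
    unfold cubicWeight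
    by_cases h1 : i = j <;> by_cases h2 : i = k <;> by_cases h3 : j = k <;> simp_all <;> ring
  simp only [h, Finset.sum_add_distrib, Finset.sum_ite_eq, Finset.mem_univ, if_true,
    Finset.sum_ite_irrel, Finset.sum_const_zero, ← Finset.mul_sum, ← Finset.sum_mul]

/-- Every cubic moment is its weight times one constant, and the moments sum to 1 because the
coordinates do. -/
theorem integral_dirichlet_mul_mul {α : ι → ℝ} (hα : ∀ i, 0 ≤ α i) (h : 0 < ∑ i, α i) (i j k : ι) :
    ∫ p, p i * p j * p k ∂dirichlet α =
      cubicWeight α i j k / ((∑ i, α i) * (∑ i, α i + 1) * (∑ i, α i + 2)) := by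
  obtain ⟨c, hc⟩ := exists_lintegral_pi_gammaLaw_prod_div hα h
  have key : ∀ i j k, ∫⁻ p, ENNReal.ofReal (p i * p j * p k) ∂dirichlet α =
      ENNReal.ofReal (cubicWeight α i j k) * c := by
    intro i j k
    -- The exponent is built one unit at a time, so each new index `k` contributes `α k` plus its
    -- earlier occurrences.
    have h3 := hc (0 + Pi.single i 1 + Pi.single j 1 + Pi.single k 1)
      (by simp [Finset.sum_add_distrib])
    simp_rw [prod_rising_add_single, prod_pow_add_single] at h3
    rw [dirichlet, lintegral_map (by fun_prop) (by fun_prop)]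
    convert h3 using 4 with g
    · simp only [Pi.zero_apply, pow_zero, Finset.prod_const_one, one_mul]
      ring
    · simp [cubicWeight, rising, Pi.single_apply, eq_comm, add_assoc]
  have hint := integrable_dirichlet_mul_mul h
  have key' : ∀ i j k, ∫ p, p i * p j * p k ∂dirichlet α = cubicWeight α i j k * c.toReal := by
    intro i j k
    have hw : 0 ≤ cubicWeight α i j k := by
      have h1 := hα i
      have h2 := hα j
      have h3 := hα k
      unfold cubicWeight
      positivity
    rw [integral_eq_lintegral_of_nonneg_ae _ (hint i j k).aestronglyMeasurable, key,
      ENNReal.toReal_mul, ENNReal.toReal_ofReal hw]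
    filter_upwards [ae_dirichlet h] with p hp
    exact mul_nonneg (mul_nonneg (hp.1 i).1 (hp.1 j).1) (hp.1 k).1
  have hsum : (∑ i, ∑ j, ∑ k, cubicWeight α i j k) * c.toReal = 1 := by
    simp_rw [Finset.sum_mul, ← key']
    simp_rw [← integral_finsetSum Finset.univ fun k _ => hint _ _ k]
    simp_rw [← integral_finsetSum Finset.univ fun j _ =>
      integrable_finsetSum Finset.univ fun k _ => hint _ j k]
    rw [← integral_finsetSum Finset.univ fun i _ => integrable_finsetSum Finset.univ fun j _ =>
      integrable_finsetSum Finset.univ fun k _ => hint i j k]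
    have : ∀ᵐ p ∂dirichlet α, ∑ i, ∑ j, ∑ k, p i * p j * p k = 1 := by
      filter_upwards [ae_dirichlet h] with p hp
      simp_rw [← Finset.mul_sum, hp.2, mul_one, ← Finset.mul_sum, hp.2, mul_one, hp.2]
    rw [integral_congr_ae this]
    simp
  -- With `s = ∑ α i`, the total weight is `s ^ 3 + 3 s ^ 2 + 2 s = s (s + 1) (s + 2)`.
  have h2 := sum_cubicWeight α 1 1 1
  simp only [Pi.one_apply, one_mul] at h2
  rw [h2] at hsum
  rw [key', eq_div_iff (by positivity)]
  linear_combination cubicWeight α i j k * hsum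

theorem integral_dirichlet_sum_mul_sum_mul_sum {α : ι → ℝ} (hα : ∀ i, 0 ≤ α i)
    (h : 0 < ∑ i, α i) (a b c : ι → ℝ) :
    ∫ p, (∑ i, a i * p i) * (∑ i, b i * p i) * (∑ i, c i * p i) ∂dirichlet α =
      ((∑ i, a i * α i) * (∑ i, b i * α i) * (∑ i, c i * α i) +
      (∑ i, a i * b i * α i) * (∑ i, c i * α i) + (∑ i, a i * c i * α i) * (∑ i, b i * α i) +
      (∑ i, b i * c i * α i) * (∑ i, a i * α i) + 2 * ∑ i, a i * b i * c i * α i) /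
        ((∑ i, α i) * (∑ i, α i + 1) * (∑ i, α i + 2)) := by
  have hint : ∀ i j k, Integrable (fun p : ι → ℝ => a i * b j * c k * (p i * p j * p k))
      (dirichlet α) := fun i j k => (integrable_dirichlet_mul_mul h i j k).const_mul _
  have e : ∀ p : ι → ℝ, (∑ i, a i * p i) * (∑ i, b i * p i) * (∑ i, c i * p i) =
      ∑ i, ∑ j, ∑ k, a i * b j * c k * (p i * p j * p k) := by
    intro p
    rw [Finset.sum_mul_sum, Finset.sum_mul]
    refine Finset.sum_congr rfl fun i _ => ?_
    rw [Finset.sum_mul]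
    refine Finset.sum_congr rfl fun j _ => ?_
    rw [Finset.mul_sum]
    exact Finset.sum_congr rfl fun k _ => by ring
  rw [integral_congr_ae (ae_of_all _ e),
    integral_finsetSum Finset.univ fun i _ => integrable_finsetSum Finset.univ fun j _ =>
      integrable_finsetSum Finset.univ fun k _ => hint i j k]
  have e1 : ∀ i j, ∫ p, ∑ k, a i * b j * c k * (p i * p j * p k) ∂dirichlet α =
      ∑ k, a i * b j * c k * (∫ p, p i * p j * p k ∂dirichlet α) := fun i j => by
    rw [integral_finsetSum Finset.univ fun k _ => hint i j k]
    exact Finset.sum_congr rfl fun k _ => integral_const_mul _ _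
  have e2 : ∀ i, ∫ p, ∑ j, ∑ k, a i * b j * c k * (p i * p j * p k) ∂dirichlet α =
      ∑ j, ∑ k, a i * b j * c k * (∫ p, p i * p j * p k ∂dirichlet α) := fun i => by
    rw [integral_finsetSum Finset.univ fun j _ => integrable_finsetSum Finset.univ fun k _ =>
      hint i j k]
    exact Finset.sum_congr rfl fun j _ => e1 i j
  simp_rw [e2, integral_dirichlet_mul_mul hα h, mul_div_assoc', ← Finset.sum_div,
    sum_cubicWeight]

end

/-! ### Conditional expectations -/

section CondExp

open Filter Topology

variable {Ω : Type*} {m m₀ mΩ : MeasurableSpace Ω} {μ : Measure Ω}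

/-- Dominated convergence for conditional expectations, without assuming `g` measurable: the limit
formulas met later need not come with a measurability proof. -/
theorem condExp_ae_eq_of_tendsto [IsFiniteMeasure μ] (hm : m ≤ mΩ) {fs gs : ℕ → Ω → ℝ}
    {f g : Ω → ℝ} {C : ℝ} (hfs : ∀ n, AEStronglyMeasurable (fs n) μ)
    (hC : ∀ n ω, |fs n ω| ≤ C) (hf : ∀ ω, Tendsto (fun n => fs n ω) atTop (𝓝 (f ω)))
    (hg : ∀ ω, Tendsto (fun n => gs n ω) atTop (𝓝 (g ω))) (h : ∀ n, μ[fs n | m] =ᵐ[μ] gs n) :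
    μ[f | m] =ᵐ[μ] g := by
  have hC' : ∀ n ω, |fs n ω| ≤ C.toNNReal := fun n ω => (hC n ω).trans (Real.le_coe_toNNReal C)
  have hgm : ∀ n, AEStronglyMeasurable[m] (gs n) μ := fun n =>
    ⟨_, stronglyMeasurable_condExp, (h n).symm⟩
  have hgb : ∀ n, ∀ᵐ ω ∂μ, ‖gs n ω‖ ≤ C.toNNReal := fun n => by
    filter_upwards [h n,
      ae_bdd_abs_condExp_of_ae_bdd_abs (m := m) (ae_of_all μ (hC' n))] with ω h1 h2
    rwa [← h1]
  have hgi : ∀ n, Integrable (gs n) μ := fun n => .of_bound ((hgm n).mono hm) _ (hgb n)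
  have hglim : AEStronglyMeasurable[m] g μ := by
    -- The pointwise limit of the actual conditional expectations is an `m`-measurable version of
    -- `g`.
    have hlim : StronglyMeasurable[m] fun ω => limUnder atTop fun n => (μ[fs n | m]) ω :=
      @StronglyMeasurable.limUnder _ _ _ m _ _ _ _ _ _ _ fun _ => stronglyMeasurable_condExp
    refine ⟨_, hlim, ?_⟩
    filter_upwards [ae_all_iff.2 h] with ω hω
    simp_rw [hω]
    exact (hg ω).limUnder_eq.symm
  have hgint : Integrable g μ := by
    refine .of_bound (hglim.mono hm) C.toNNReal ?_
    filter_upwards [ae_all_iff.2 hgb] with ω hω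
    exact le_of_tendsto (hg ω).norm (Eventually.of_forall hω)
  refine (tendsto_condExp_unique fs gs f g (fun n => .of_bound (hfs n) _ (ae_of_all μ (hC n))) hgi
    (ae_of_all μ hf) (ae_of_all μ hg) (fun _ => C) (integrable_const _) (fun _ => C.toNNReal)
    (integrable_const _) (fun n => ae_of_all μ (hC n)) hgb fun n => ?_).trans
    (condExp_of_aestronglyMeasurable' hm hglim hgint)
  exact (h n).trans (condExp_of_aestronglyMeasurable' hm (hgm n) (hgi n)).symm

theorem integral_comp_simpleFunc {E X : Type*} [MeasurableSpace X] (s : SimpleFunc X E)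
    (ν : Measure X) [IsFiniteMeasure ν] (a : E → ℝ) :
    ∫ t, a (s t) ∂ν = ∑ v ∈ s.range, a v * ν.real (s ⁻¹' {v}) := by
  have h : ∀ t, a (s t) = ∑ v ∈ s.range, (s ⁻¹' {v}).indicator (fun _ => a v) t := by
    intro t
    rw [Finset.sum_eq_single (s t) _ (fun h => absurd (s.mem_range_self t) h)]
    · simp
    · intro v _ hv
      exact Set.indicator_of_notMem (fun h => hv h.symm) _
  simp_rw [h]
  rw [integral_finsetSum _ fun v _ => (integrable_const _).indicator (s.measurableSet_fiber v)]
  refine Finset.sum_congr rfl fun v _ => ?_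
  rw [integral_indicator_const _ (s.measurableSet_fiber v), smul_eq_mul, mul_comm]

/-- If `ν` is the conditional law of `Y` given `m`, then `μ[ψ ∘ Y | m] = ∫ ψ dν`. -/
theorem condExp_comp_of_condLaw {E : Type*} [MeasurableSpace E] [IsFiniteMeasure μ] (hm : m ≤ mΩ)
    {Y : Ω → E} (hY : Measurable Y) {ν : Ω → Measure E} [∀ ω, IsProbabilityMeasure (ν ω)]
    (h : ∀ B, MeasurableSet B →
      μ[(Y ⁻¹' B).indicator (fun _ => (1 : ℝ)) | m] =ᵐ[μ] fun ω => (ν ω).real B)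
    {ψ : E → ℝ} (hψ : Measurable ψ) {C : ℝ} (hC : ∀ y, |ψ y| ≤ C) :
    μ[fun ω => ψ (Y ω) | m] =ᵐ[μ] fun ω => ∫ y, ψ y ∂ν ω := by
  have hψ' := hψ.stronglyMeasurable
  -- A point of `E` is needed to deduce `0 ≤ C`.
  rcases isEmpty_or_nonempty E with hE | ⟨⟨y⟩⟩
  · have : IsEmpty Ω := ⟨fun ω => hE.elim (Y ω)⟩
    exact ae_of_all _ fun ω => this.elim ω
  have hC0 : 0 ≤ C := (abs_nonneg _).trans (hC y)
  set s := fun n => hψ'.approxBounded C n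
  have hs : ∀ n y, |s n y| ≤ C := fun n y => hψ'.norm_approxBounded_le hC0 n y
  have hlim : ∀ y, Tendsto (fun n => s n y) atTop (𝓝 (ψ y)) := fun y =>
    hψ'.tendsto_approxBounded_of_norm_le (hC y)
  refine condExp_ae_eq_of_tendsto hm (fs := fun n ω => s n (Y ω))
    (gs := fun n ω => ∫ y, s n y ∂ν ω)
    (fun n => ((s n).measurable.comp hY).aestronglyMeasurable) (fun n ω => hs n (Y ω))
    (fun ω => hlim (Y ω)) (fun ω => ?_) fun n => ?_
  · exact tendsto_integral_of_dominated_convergence (fun _ => C)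
      (fun n => (s n).aestronglyMeasurable) (integrable_const _)
      (fun n => ae_of_all _ (hs n)) (ae_of_all _ hlim)
  · have e : (fun ω => s n (Y ω)) = ∑ v ∈ (s n).range,
        v • (Y ⁻¹' (s n ⁻¹' {v})).indicator (fun _ => (1 : ℝ)) := by
      funext ω
      rw [Finset.sum_apply, Finset.sum_eq_single (s n (Y ω)) _
        (fun h => absurd ((s n).mem_range_self _) h)]
      · simp [Set.indicator]
      · intro v _ hv
        simp [Set.indicator, hv.symm]
    have hi : ∀ v : ℝ, Integrable
        (v • (Y ⁻¹' (s n ⁻¹' {v})).indicator (fun _ => (1 : ℝ))) μ := fun v =>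
      ((integrable_const _).indicator (hY ((s n).measurableSet_fiber v))).smul v
    rw [e]
    have hv : ∀ v : ℝ, μ[v • (Y ⁻¹' (s n ⁻¹' {v})).indicator (fun _ => (1 : ℝ)) | m] =ᵐ[μ]
        fun ω => v * (ν ω).real (s n ⁻¹' {v}) := fun v => by
      filter_upwards [condExp_smul (μ := μ) v
        ((Y ⁻¹' (s n ⁻¹' {v})).indicator (fun _ => (1 : ℝ))) m,
        h _ ((s n).measurableSet_fiber v)] with ω h1 h2
      rw [h1, Pi.smul_apply, h2, smul_eq_mul]
    filter_upwards [condExp_finsetSum (fun v (_ : v ∈ (s n).range) => hi v) m,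
      (ae_ball_iff (s n).range.countable_toSet).2 fun v _ => hv v] with ω h1 h2
    rw [h1, Finset.sum_apply, Finset.sum_congr rfl h2]
    exact (integral_comp_simpleFunc (s n) (ν ω) id).symm

/-- Condition first on the larger σ-algebra, where `Z` pulls out, then apply the tower property. -/
theorem condExp_mul_congr_of_le [IsFiniteMeasure μ] (h₀ : m₀ ≤ m)
    (hm : m ≤ mΩ) {Z Y g : Ω → ℝ} (hZ : StronglyMeasurable[m] Z) (hZY : Integrable (Z * Y) μ)
    (hY : Integrable Y μ) (h : μ[Y | m] =ᵐ[μ] g) : μ[Z * Y | m₀] =ᵐ[μ] μ[Z * g | m₀] := by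
  refine (condExp_condExp_of_le h₀ hm).symm.trans (condExp_congr_ae ?_)
  exact (condExp_mul_of_stronglyMeasurable_left hZ hZY hY).trans
    (h.mono fun ω hω => by simp [hω])

/-- Replacing every factor of a product by its conditional expectation given the other factors. -/
theorem condExp_prod_mul_congr [IsFiniteMeasure μ] {ι : Type*} [DecidableEq ι]
    {ℱ : ι → MeasurableSpace Ω} (h₀ : ∀ s, m₀ ≤ ℱ s) (hℱ : ∀ s, ℱ s ≤ mΩ) {Y g : ι → Ω → ℝ}
    (hY : ∀ s t, s ≠ t → Measurable[ℱ t] (Y s)) (hg : ∀ s t, Measurable[ℱ t] (g s))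
    (hYm : ∀ s, Measurable (Y s)) (hYb : ∀ s ω, |Y s ω| ≤ 1) (hgb : ∀ s ω, |g s ω| ≤ 1)
    (h : ∀ s, μ[Y s | ℱ s] =ᵐ[μ] g s) (S : Finset ι) {Z : Ω → ℝ}
    (hZ : ∀ t, Measurable[ℱ t] (Z)) (hZm : Measurable Z) (hZb : ∀ ω, |Z ω| ≤ 1) :
    μ[Z * ∏ s ∈ S, Y s | m₀] =ᵐ[μ] μ[Z * ∏ s ∈ S, g s | m₀] := by
  -- `Z` collects the factors already replaced; it stays measurable for every `ℱ t` because each `g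
  -- s` is.
  induction S using Finset.induction_on generalizing Z with
  | empty => rfl
  | insert s S hs ih =>
    rw [Finset.prod_insert hs, Finset.prod_insert hs]
    have hP : Measurable[ℱ s] (Z * ∏ t ∈ S, Y t) :=
      (hZ s).mul (by
        rw [Finset.prod_fn]
        exact Finset.measurable_prod _ fun t ht => hY t s (by rintro rfl; exact hs ht))
    have hPb : ∀ ω, |(Z * ∏ t ∈ S, Y t) ω| ≤ 1 := fun ω => by
      rw [Pi.mul_apply, abs_mul, Finset.prod_apply, Finset.abs_prod]
      exact mul_le_one₀ (hZb ω) (Finset.prod_nonneg fun _ _ => abs_nonneg _)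
        (Finset.prod_le_one (fun _ _ => abs_nonneg _) fun t _ => hYb t ω)
    have hYi : Integrable (Y s) μ := .of_bound (hYm s).aestronglyMeasurable 1
      (ae_of_all _ (hYb s))
    have h1 := condExp_mul_congr_of_le (h₀ s) (hℱ s) hP.stronglyMeasurable
      (.of_bound (((hP.mono (hℱ s) le_rfl).mul (hYm s)).aestronglyMeasurable) 1
        (ae_of_all _ fun ω => by
          rw [Pi.mul_apply, norm_mul]
          exact mul_le_one₀ (hPb ω) (norm_nonneg _) (hYb s ω))) hYi (h s)
    have h2 := ih (Z := Z * g s) (fun t => (hZ t).mul (hg s t))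
      (hZm.mul ((hg s s).mono (hℱ s) le_rfl)) (fun ω => by
        rw [Pi.mul_apply, abs_mul]
        exact mul_le_one₀ (hZb ω) (abs_nonneg _) (hgb s ω))
    rw [show Z * (Y s * ∏ t ∈ S, Y t) = (Z * ∏ t ∈ S, Y t) * Y s by ring,
      show Z * (g s * ∏ t ∈ S, g t) = Z * g s * ∏ t ∈ S, g t by ring]
    refine h1.trans ?_
    rwa [show (Z * ∏ t ∈ S, Y t) * g s = Z * g s * ∏ t ∈ S, Y t by ring]

end CondExp

/-! ### Moments of Dirichlet processes -/

section DirichletProcess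

open Filter Topology

/-- The third moment `E[∫ f dG ∫ g dG ∫ k dG]` of a Dirichlet process `G` with concentration `γ`
and base measure `ν`. -/
def dpMoment {X : Type*} [MeasurableSpace X] (γ : ℝ) (ν : Measure X) (f g k : X → ℝ) : ℝ :=
  (γ ^ 2 * ((∫ t, f t ∂ν) * (∫ t, g t ∂ν) * ∫ t, k t ∂ν) +
    γ * ((∫ t, f t * g t ∂ν) * (∫ t, k t ∂ν) + (∫ t, f t * k t ∂ν) * (∫ t, g t ∂ν) +
      (∫ t, g t * k t ∂ν) * (∫ t, f t ∂ν)) + 2 * ∫ t, f t * g t * k t ∂ν) / ((γ + 1) * (γ + 2))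

variable {Ω Θ : Type*} [MeasurableSpace Θ] {m mΩ : MeasurableSpace Ω} {μ : Measure Ω}
  {γ : ℝ} {G₀ G : Ω → Measure Θ}

/-- The fibres of `s` form a finite partition, on which the integrals are linear forms in Dirichlet
distributed masses. All three integrands factor through the same `s`, so one partition suffices. -/
theorem CondDirichletProcess.condExp_simpleFunc [IsFiniteMeasure μ] (hm : m ≤ mΩ) (hγ : 0 < γ)
    (hG : Measurable G) [∀ ω, IsProbabilityMeasure (G ω)] [∀ ω, IsProbabilityMeasure (G₀ ω)]
    (h : CondDirichletProcess μ m γ G₀ G) {E : Type*} (s : SimpleFunc Θ E) (a b c : E → ℝ) :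
    μ[fun ω => (∫ t, a (s t) ∂G ω) * (∫ t, b (s t) ∂G ω) * ∫ t, c (s t) ∂G ω | m] =ᵐ[μ]
      fun ω => dpMoment γ (G₀ ω) (fun t => a (s t)) (fun t => b (s t)) (fun t => c (s t)) := by
  set e := s.range.equivFin.symm with he
  set A : Fin s.range.card → Set Θ := fun k => s ⁻¹' {(e k : E)} with hA
  have hint : ∀ (ν : Measure Θ) [IsFiniteMeasure ν] (a : E → ℝ),
      ∫ t, a (s t) ∂ν = ∑ k, a (e k) * ν.real (A k) := by
    intro ν _ a
    rw [integral_comp_simpleFunc, ← Finset.sum_coe_sort]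
    exact (Equiv.sum_comp e fun v : s.range => a v * ν.real (s ⁻¹' {(v : E)})).symm
  have hpart : IsPartition A := by
    refine ⟨fun k => s.measurableSet_fiber _, fun k l hkl => ?_, Set.eq_univ_of_forall fun t => ?_⟩
    · refine Set.disjoint_left.2 fun t ht ht' => hkl ?_
      have h1 : s t = e k := ht
      have h2 : s t = e l := ht'
      exact e.injective (Subtype.ext (h1.symm.trans h2))
    · refine Set.mem_iUnion.2 ⟨e.symm ⟨s t, s.mem_range_self t⟩, ?_⟩
      simp [hA]
  have hreal : ∀ B, MeasurableSet B → Measurable fun ω => (G ω).real B := fun B hB =>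
    ((Measure.measurable_coe hB).comp hG).ennreal_toReal
  -- The cubic form `ψ` is unbounded, so it is cut off outside the unit cube, which carries both the
  -- masses and the Dirichlet law.
  set cube : Set (Fin s.range.card → ℝ) := Set.univ.pi fun _ => Set.Icc 0 1 with hcube
  have hcube_meas : MeasurableSet cube :=
    MeasurableSet.univ_pi fun _ => measurableSet_Icc
  set ψ : (Fin s.range.card → ℝ) → ℝ :=
    fun p => (∑ i, a (e i) * p i) * (∑ i, b (e i) * p i) * (∑ i, c (e i) * p i) with hψ
  have hlin : ∀ (a : E → ℝ), ∀ p ∈ cube, |∑ i, a (e i) * p i| ≤ ∑ i, |a (e i)| := by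
    intro a p hp
    refine (Finset.abs_sum_le_sum_abs _ _).trans (Finset.sum_le_sum fun i _ => ?_)
    have := hp i (Set.mem_univ i)
    rw [abs_mul, abs_of_nonneg this.1]
    exact mul_le_of_le_one_right (abs_nonneg _) this.2
  have hbound : ∀ p, |cube.indicator ψ p| ≤
      (∑ i, |a (e i)|) * (∑ i, |b (e i)|) * (∑ i, |c (e i)|) := by
    intro p
    by_cases hp : p ∈ cube
    · rw [Set.indicator_of_mem hp, hψ, abs_mul, abs_mul]
      have := hlin a p hp
      have := hlin b p hp
      have := hlin c p hp
      gcongr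
    · rw [Set.indicator_of_notMem hp, abs_zero]
      positivity
  have key := condExp_comp_of_condLaw hm
    (measurable_pi_lambda (fun ω k => (G ω).real (A k)) fun k => hreal _ (hpart.1 k))
    (h _ A hpart) ((show Measurable ψ by fun_prop).indicator hcube_meas) hbound
  have hmem : ∀ ω, (fun k => (G ω).real (A k)) ∈ cube := fun ω k _ =>
    ⟨measureReal_nonneg, measureReal_le_one⟩
  simp_rw [Set.indicator_of_mem (hmem _)] at key
  have e1 : (fun ω => ψ fun k => (G ω).real (A k)) =
      fun ω => (∫ t, a (s t) ∂G ω) * (∫ t, b (s t) ∂G ω) * ∫ t, c (s t) ∂G ω := by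
    funext ω
    simp only [hψ, hint]
  rw [e1] at key
  refine key.trans (ae_of_all _ fun ω => ?_)
  -- The total parameter is `γ`; one factor `γ` later cancels from the denominator `γ (γ + 1) (γ +
  -- 2)`.
  have hsum : ∑ k, γ * (G₀ ω).real (A k) = γ := by
    have := hint (G₀ ω) 1
    simp only [Pi.one_apply, integral_const, probReal_univ, one_smul, one_mul] at this
    rw [← Finset.mul_sum, ← this, mul_one]
  have hpos : 0 < ∑ k, γ * (G₀ ω).real (A k) := by rwa [hsum]
  simp only
  have hae : cube.indicator ψ =ᵐ[dirichlet fun k => γ * (G₀ ω).real (A k)] ψ := by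
    filter_upwards [ae_dirichlet hpos] with p hp
    exact Set.indicator_of_mem (show p ∈ cube from fun i _ => hp.1 i) _
  rw [integral_congr_ae hae, hψ,
    integral_dirichlet_sum_mul_sum_mul_sum (fun k => mul_nonneg hγ.le measureReal_nonneg) hpos,
    hsum, dpMoment]
  simp only [hint (G₀ ω) a, hint (G₀ ω) b, hint (G₀ ω) c, hint (G₀ ω) fun v => a v * b v,
    hint (G₀ ω) fun v => a v * c v, hint (G₀ ω) fun v => b v * c v,
    hint (G₀ ω) fun v => a v * b v * c v, mul_left_comm _ γ, ← Finset.mul_sum]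
  field_simp
  ring

theorem CondDirichletProcess.condExp_integral_mul_mul [IsFiniteMeasure μ] (hm : m ≤ mΩ)
    (hγ : 0 < γ) (hG : Measurable G) [∀ ω, IsProbabilityMeasure (G ω)]
    [∀ ω, IsProbabilityMeasure (G₀ ω)] (h : CondDirichletProcess μ m γ G₀ G) {f g k : Θ → ℝ}
    (hf : Measurable f) (hg : Measurable g) (hk : Measurable k) (hf1 : ∀ t, |f t| ≤ 1)
    (hg1 : ∀ t, |g t| ≤ 1) (hk1 : ∀ t, |k t| ≤ 1) :
    μ[fun ω => (∫ t, f t ∂G ω) * (∫ t, g t ∂G ω) * ∫ t, k t ∂G ω | m] =ᵐ[μ]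
      fun ω => dpMoment γ (G₀ ω) f g k := by
  have happ : ∀ f : Θ → ℝ, Measurable f → (∀ t, |f t| ≤ 1) → ∃ s : ℕ → SimpleFunc Θ ℝ,
      (∀ n t, |s n t| ≤ 1) ∧ ∀ t, Tendsto (fun n => s n t) atTop (𝓝 (f t)) :=
    fun f hf hf1 => ⟨fun n => hf.stronglyMeasurable.approxBounded 1 n,
      fun n t => hf.stronglyMeasurable.norm_approxBounded_le zero_le_one n t,
      fun t => hf.stronglyMeasurable.tendsto_approxBounded_of_norm_le (hf1 t)⟩
  obtain ⟨u, hu1, hu⟩ := happ f hf hf1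
  obtain ⟨v, hv1, hv⟩ := happ g hg hg1
  obtain ⟨w, hw1, hw⟩ := happ k hk hk1
  have hlim : ∀ (ν : Measure Θ) [IsProbabilityMeasure ν] (s : ℕ → Θ → ℝ) (f : Θ → ℝ),
      (∀ n, Measurable (s n)) → (∀ n t, |s n t| ≤ 1) →
      (∀ t, Tendsto (fun n => s n t) atTop (𝓝 (f t))) →
      Tendsto (fun n => ∫ t, s n t ∂ν) atTop (𝓝 (∫ t, f t ∂ν)) := fun ν _ s f hm h1 hs =>
    tendsto_integral_of_dominated_convergence (fun _ => 1)
      (fun n => (hm n).aestronglyMeasurable) (integrable_const _)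
      (fun n => ae_of_all _ (h1 n)) (ae_of_all _ hs)
  have hint1 : ∀ (ω : Ω) (s : Θ → ℝ), (∀ t, |s t| ≤ 1) → |∫ t, s t ∂G ω| ≤ 1 := fun ω s h1 => by
    simpa using norm_integral_le_of_norm_le_const (μ := G ω) (f := s) (C := 1) (ae_of_all _ h1)
  have hmeas : ∀ s : Θ → ℝ, Measurable s → Measurable fun ω => ∫ t, s t ∂G ω := fun s hs =>
    (hs.stronglyMeasurable.integral_kernel (κ := (⟨G, hG⟩ : Kernel Ω Θ))).measurable
  have mul1 : ∀ {x y : ℝ}, |x| ≤ 1 → |y| ≤ 1 → |x * y| ≤ 1 := fun hx hy => by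
    rw [abs_mul]
    exact mul_le_one₀ hx (abs_nonneg _) hy
  refine condExp_ae_eq_of_tendsto hm (C := 1)
    (fs := fun n ω => (∫ t, u n t ∂G ω) * (∫ t, v n t ∂G ω) * ∫ t, w n t ∂G ω)
    (gs := fun n ω => dpMoment γ (G₀ ω) (u n) (v n) (w n)) (fun n => ?_) (fun n ω => ?_)
    (fun ω => ?_) (fun ω => ?_) fun n => ?_
  · exact (((hmeas _ (u n).measurable).mul (hmeas _ (v n).measurable)).mul
      (hmeas _ (w n).measurable)).aestronglyMeasurable
  · exact mul1 (mul1 (hint1 ω _ (hu1 n)) (hint1 ω _ (hv1 n))) (hint1 ω _ (hw1 n))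
  · exact ((hlim _ _ f (fun n => (u n).measurable) hu1 hu).mul
      (hlim _ _ g (fun n => (v n).measurable) hv1 hv)).mul
      (hlim _ _ k (fun n => (w n).measurable) hw1 hw)
  · have lu := hlim (G₀ ω) _ f (fun n => (u n).measurable) hu1 hu
    have lv := hlim (G₀ ω) _ g (fun n => (v n).measurable) hv1 hv
    have lw := hlim (G₀ ω) _ k (fun n => (w n).measurable) hw1 hw
    have luv := hlim (G₀ ω) _ _ (fun n => (u n).measurable.mul (v n).measurable)
      (fun n t => mul1 (hu1 n t) (hv1 n t)) fun t => (hu t).mul (hv t)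
    have luw := hlim (G₀ ω) _ _ (fun n => (u n).measurable.mul (w n).measurable)
      (fun n t => mul1 (hu1 n t) (hw1 n t)) fun t => (hu t).mul (hw t)
    have lvw := hlim (G₀ ω) _ _ (fun n => (v n).measurable.mul (w n).measurable)
      (fun n t => mul1 (hv1 n t) (hw1 n t)) fun t => (hv t).mul (hw t)
    have luvw := hlim (G₀ ω) _ _
      (fun n => ((u n).measurable.mul (v n).measurable).mul (w n).measurable)
      (fun n t => mul1 (mul1 (hu1 n t) (hv1 n t)) (hw1 n t))
      fun t => ((hu t).mul (hv t)).mul (hw t)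
    exact (((((lu.mul lv).mul lw).const_mul _).add
      ((((luv.mul lw).add (luw.mul lv)).add (lvw.mul lu)).const_mul _)).add
      (luvw.const_mul _)).div_const _
  -- The three approximants are paired into one simple function, giving a common refinement of their
  -- partitions.
  · exact h.condExp_simpleFunc hm hγ hG ((u n).pair ((v n).pair (w n))) Prod.fst
      (fun p => p.2.1) (fun p => p.2.2)

end DirichletProcess

/-! ### The coefficients -/

section Coefficients

variable {γ : ℕ → ℝ} {L l : ℕ}

theorem C2_bottom (h : ¬l + 1 < L) : C2 γ L l = 1 := by rw [C2, if_neg h]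
theorem C3_bottom (h : ¬l + 1 < L) : C3 γ L l = 0 := by rw [C3, if_neg h]
theorem C4_bottom (h : ¬l + 1 < L) : C4 γ L l = 1 := by rw [C4, if_neg h]
theorem C5_bottom (h : ¬l + 1 < L) : C5 γ L l = 0 := by rw [C5, if_neg h]
theorem C6_bottom (h : ¬l + 1 < L) : C6 γ L l = 0 := by rw [C6, if_neg h]

theorem C2_step (h : l + 1 < L) : C2 γ L l = γ (l + 1) / (γ (l + 1) + 1) * C2 γ L (l + 1) := by
  rw [C2, if_pos h]

theorem C4_step (h : l + 1 < L) : C4 γ L l =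
    γ (l + 1) ^ 2 / ((γ (l + 1) + 1) * (γ (l + 1) + 2)) * C4 γ L (l + 1) := by
  rw [C4, if_pos h]

/-- In terms of level `l + 1` alone this is the coefficient of `∫fg`: the term `∫f ∫g` of a child
contributes it with factor `1 / (γ + 1)`. -/
theorem C3_step (hγ : ∀ l < L, 0 < γ l) (h : l + 1 < L) :
    C3 γ L l = C3 γ L (l + 1) + C2 γ L (l + 1) / (γ (l + 1) + 1) := by
  have := hγ _ h
  rw [C3, if_pos h, C2_step h]
  field_simp

theorem C2_pos (hγ : ∀ l < L, 0 < γ l) (l : ℕ) : 0 < C2 γ L l := by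
  rcases lt_or_ge (l + 1) L with h | h
  · have := hγ _ h
    have := C2_pos hγ (l + 1)
    rw [C2_step h]
    positivity
  · rw [C2_bottom h.not_gt]
    exact one_pos
termination_by L - l

theorem C3_nonneg (hγ : ∀ l < L, 0 < γ l) (l : ℕ) : 0 ≤ C3 γ L l := by
  rcases lt_or_ge (l + 1) L with h | h
  · have := hγ _ h
    have := C3_nonneg hγ (l + 1)
    have := C2_pos hγ (l + 1)
    rw [C3_step hγ h]
    positivity
  · rw [C3_bottom h.not_gt]
termination_by L - l

theorem C3_pos (hγ : ∀ l < L, 0 < γ l) (h : l + 1 < L) : 0 < C3 γ L l := by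
  have := hγ _ h
  have := C3_nonneg hγ (l + 1)
  have := C2_pos hγ (l + 1)
  rw [C3_step hγ h]
  positivity

/-- Multiplying by `C3` clears the quotient in the recursion. The summands are the shares passed to
`∫fg ∫k` by the same term and by `∫f ∫g ∫k` of a child. -/
theorem C5_mul_C3_step (hγ : ∀ l < L, 0 < γ l) (h : l + 1 < L) :
    C5 γ L l * C3 γ L l = γ (l + 1) / (γ (l + 1) + 1) * (C5 γ L (l + 1) * C3 γ L (l + 1)) +
      γ (l + 1) / ((γ (l + 1) + 1) * (γ (l + 1) + 2)) * C4 γ L (l + 1) := by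
  have := hγ _ h
  have := C3_pos hγ h
  rw [C5, if_pos h, C4_step h]
  field_simp

/-- The subtracted term of the definition is absorbed: of three copies of `C4 / ((γ + 1) (γ + 2))`
at level `l + 1`, two remain. All contributions to `∫fgk` are now visible. -/
theorem C6_step (hγ : ∀ l < L, 0 < γ l) (h : l + 1 < L) :
    C6 γ L l = C6 γ L (l + 1) + 3 * (C5 γ L (l + 1) * C3 γ L (l + 1)) / (γ (l + 1) + 1) +
      2 * C4 γ L (l + 1) / ((γ (l + 1) + 1) * (γ (l + 1) + 2)) := by
  have := hγ _ h
  rw [C6, if_pos h, C5_mul_C3_step hγ h, C4_step h]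
  field_simp
  ring

/-! ### Closed forms of the coefficients at height `h` above the bottom level -/

section ClosedForm

variable {h : ℕ}

theorem pred_sub_succ (hh : h + 1 ≤ L - 1) : L - 1 - (h + 1) + 1 = L - 1 - h := by
  omega
theorem pred_sub_succ_lt (hh : h + 1 ≤ L - 1) : L - 1 - (h + 1) + 1 < L := by omega
theorem pred_sub_eq : L - 1 - h = L - (h + 1) := by omega

theorem C2_eq_prod (hh : h ≤ L - 1) :
    C2 γ L (L - 1 - h) = ∏ k ∈ Finset.Icc 1 h, γ (L - k) / (γ (L - k) + 1) := by
  induction h with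
  | zero => rw [C2_bottom (by omega)]; simp
  | succ h ih =>
    rw [C2_step (pred_sub_succ_lt hh), pred_sub_succ hh, ih (by omega), pred_sub_eq,
      Finset.prod_Icc_succ_top (by omega), mul_comm]

theorem C4_eq_prod (hh : h ≤ L - 1) : C4 γ L (L - 1 - h) =
    ∏ k ∈ Finset.Icc 1 h, γ (L - k) ^ 2 / ((γ (L - k) + 1) * (γ (L - k) + 2)) := by
  induction h with
  | zero => rw [C4_bottom (by omega)]; simp
  | succ h ih =>
    rw [C4_step (pred_sub_succ_lt hh), pred_sub_succ hh, ih (by omega), pred_sub_eq,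
      Finset.prod_Icc_succ_top (by omega), mul_comm]

theorem C3_eq_sum (hγ : ∀ l < L, 0 < γ l) (hh : h ≤ L - 1) : C3 γ L (L - 1 - h) =
    ∑ i ∈ Finset.Icc 1 h,
      (∏ j ∈ Finset.Icc 1 (i - 1), γ (L - j)) / ∏ j ∈ Finset.Icc 1 i, (γ (L - j) + 1) := by
  induction h with
  | zero => rw [C3_bottom (by omega)]; simp
  | succ h ih =>
    rw [C3_step hγ (pred_sub_succ_lt hh), pred_sub_succ hh, ih (by omega), C2_eq_prod (by omega),
      pred_sub_eq, Finset.sum_Icc_succ_top (by omega), Finset.prod_div_distrib, div_div,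
      ← Finset.prod_Icc_succ_top (f := fun j => γ (L - j) + 1) (by omega), Nat.add_sub_cancel]

theorem C5_mul_C3_eq_sum (hγ : ∀ l < L, 0 < γ l) (hh : h ≤ L - 1) :
    C5 γ L (L - 1 - h) * C3 γ L (L - 1 - h) =
    (∑ i ∈ Finset.Icc 1 h, (∏ j ∈ Finset.Icc 1 (i - 1), γ (L - j)) /
      ∏ j ∈ Finset.Icc 1 i, (γ (L - j) + 2)) *
        ∏ j ∈ Finset.Icc 1 h, γ (L - j) / (γ (L - j) + 1) := by
  induction h with
  | zero => rw [C5_bottom (by omega)]; simp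
  | succ h ih =>
    rw [C5_mul_C3_step hγ (pred_sub_succ_lt hh), pred_sub_succ hh, ih (by omega),
      C4_eq_prod (by omega), pred_sub_eq, Finset.sum_Icc_succ_top (by omega),
      Finset.prod_Icc_succ_top (by omega), Finset.prod_Icc_succ_top (by omega),
      Nat.add_sub_cancel]
    -- Splitting off the product that multiplies the whole sum leaves the new summand with
    -- denominators `γ + 2`.
    have h4 : ∏ k ∈ Finset.Icc 1 h, γ (L - k) ^ 2 / ((γ (L - k) + 1) * (γ (L - k) + 2)) =
        (∏ k ∈ Finset.Icc 1 h, γ (L - k) / (γ (L - k) + 1)) *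
          ((∏ k ∈ Finset.Icc 1 h, γ (L - k)) / ∏ k ∈ Finset.Icc 1 h, (γ (L - k) + 2)) := by
      rw [← Finset.prod_div_distrib, ← Finset.prod_mul_distrib]
      refine Finset.prod_congr rfl fun k _ => ?_
      rw [div_mul_div_comm, sq]
    rw [h4]
    simp only [div_eq_mul_inv, mul_inv]
    ring

/-- The larger index `j` is the outer one, so that raising the height adds a single outer summand,
namely the previous value of `C5 * C3` over `γ + 1`. -/
theorem C6_eq_sum (hγ : ∀ l < L, 0 < γ l) (hh : h ≤ L - 1) : C6 γ L (L - 1 - h) =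
    3 * ∑ j ∈ Finset.Icc 1 h, ∑ i ∈ Finset.Icc 1 (j - 1),
        ((∏ k ∈ Finset.Icc 1 (i - 1), γ (L - k)) * ∏ k ∈ Finset.Icc 1 (j - 1), γ (L - k)) /
          ((∏ k ∈ Finset.Icc 1 i, (γ (L - k) + 2)) * ∏ k ∈ Finset.Icc 1 j, (γ (L - k) + 1)) +
      2 * ∑ i ∈ Finset.Icc 1 h, (∏ j ∈ Finset.Icc 1 (i - 1), γ (L - j) ^ 2) /
          ∏ j ∈ Finset.Icc 1 i, ((γ (L - j) + 1) * (γ (L - j) + 2)) := by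
  induction h with
  | zero => rw [C6_bottom (by omega)]; simp
  | succ h ih =>
    rw [C6_step hγ (pred_sub_succ_lt hh), pred_sub_succ hh, ih (by omega),
      C5_mul_C3_eq_sum hγ (by omega),
      C4_eq_prod (by omega), pred_sub_eq, Finset.sum_Icc_succ_top (by omega),
      Finset.sum_Icc_succ_top (by omega), Nat.add_sub_cancel]
    simp_rw [← div_mul_div_comm, ← Finset.sum_mul]
    rw [Finset.prod_Icc_succ_top (b := h) (by omega) fun k => γ (L - k) + 1,
      Finset.prod_Icc_succ_top (b := h) (by omega) fun j => (γ (L - j) + 1) * (γ (L - j) + 2),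
      Finset.prod_div_distrib, Finset.prod_div_distrib]
    simp only [div_eq_mul_inv, mul_inv]
    ring

theorem prod_Icc_reflect (f : ℕ → ℝ) :
    ∏ i ∈ Finset.Icc 1 (L - 1), f (L - i) = ∏ i ∈ Finset.Icc 1 (L - 1), f i :=
  Finset.prod_nbij' (fun i => L - i) (fun i => L - i) (by simp; omega) (by simp; omega)
    (by simp; omega) (by simp; omega) (by simp)

theorem sum_Icc_lt_comm (f : ℕ → ℕ → ℝ) (n : ℕ) :
    ∑ j ∈ Finset.Icc 1 n, ∑ i ∈ Finset.Icc 1 (j - 1), f i j =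
      ∑ i ∈ Finset.Icc 1 (n - 1), ∑ j ∈ Finset.Icc (i + 1) n, f i j :=
  Finset.sum_comm' (by simp; omega)

end ClosedForm

end Coefficients

/-! ### Linear combinations of conditional expectations -/

section HasCondExp

variable {Ω : Type*} {m m₀ mΩ : MeasurableSpace Ω} {μ : Measure Ω} {X X' Y Y' : Ω → ℝ}

/-- The integrable random variable `X` has the conditional expectation `Y` given `m`. -/
def HasCondExp (μ : Measure Ω) (m : MeasurableSpace Ω) (X Y : Ω → ℝ) : Prop :=
  Integrable X μ ∧ μ[X | m] =ᵐ[μ] Y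

theorem HasCondExp.add (h : HasCondExp μ m X Y) (h' : HasCondExp μ m X' Y') :
    HasCondExp μ m (fun ω => X ω + X' ω) (fun ω => Y ω + Y' ω) :=
  ⟨h.1.add h'.1, (condExp_add h.1 h'.1 m).trans (h.2.add h'.2)⟩

theorem HasCondExp.const_mul (h : HasCondExp μ m X Y) (c : ℝ) :
    HasCondExp μ m (fun ω => c * X ω) (fun ω => c * Y ω) :=
  ⟨h.1.const_mul c, (condExp_smul c X m).trans (h.2.mono fun ω hω => by simp [hω])⟩

theorem HasCondExp.sum {ι : Type*} {S : Finset ι} {X Y : ι → Ω → ℝ}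
    (h : ∀ j ∈ S, HasCondExp μ m (X j) (Y j)) :
    HasCondExp μ m (fun ω => ∑ j ∈ S, X j ω) (fun ω => ∑ j ∈ S, Y j ω) := by
  have e : (fun ω => ∑ j ∈ S, X j ω) = ∑ j ∈ S, X j := by
    funext ω
    rw [Finset.sum_apply]
  refine ⟨integrable_finsetSum S fun j hj => (h j hj).1, ?_⟩
  rw [e]
  filter_upwards [condExp_finsetSum (fun j hj => (h j hj).1) m,
    (ae_ball_iff S.countable_toSet).2 fun j hj => (h j hj).2] with ω h1 h2
  rw [h1, Finset.sum_apply, Finset.sum_congr rfl h2]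

theorem HasCondExp.congr_left (h : HasCondExp μ m X Y) (hX : X' =ᵐ[μ] X) :
    HasCondExp μ m X' Y :=
  ⟨h.1.congr hX.symm, (condExp_congr_ae hX).trans h.2⟩

theorem HasCondExp.congr_right (h : HasCondExp μ m X Y) (hY : Y =ᵐ[μ] Y') :
    HasCondExp μ m X Y' := ⟨h.1, h.2.trans hY⟩

/-- By the tower property, a conditional expectation that depends only on less information is also
the one given that information. This replaces the whole past of a child by its parent. -/
theorem HasCondExp.of_le [IsFiniteMeasure μ] (h : HasCondExp μ m X Y) (h₀ : m₀ ≤ m) (hm : m ≤ mΩ)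
    (hY : Measurable[m₀] Y) : HasCondExp μ m₀ X Y := by
  refine ⟨h.1, ((condExp_condExp_of_le h₀ hm).symm.trans (condExp_congr_ae h.2)).trans ?_⟩
  rw [condExp_of_stronglyMeasurable (h₀.trans hm) hY.stronglyMeasurable
    (integrable_condExp.congr h.2)]

end HasCondExp

/-! ### Moment functionals of Dirichlet processes -/

section Functional

variable {X : Type*} [MeasurableSpace X]

/-- The value of the second moment at level `l`, as a function of the node distribution. -/
def momentFunctional2 (γ : ℕ → ℝ) (L : ℕ) (f g : X → ℝ) (l : ℕ) (ν : Measure X) : ℝ :=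
  C2 γ L l * ((∫ t, f t ∂ν) * ∫ t, g t ∂ν) + C3 γ L l * ∫ t, f t * g t ∂ν

/-- The value of the third moment at level `l`, as a function of the node distribution. -/
def momentFunctional3 (γ : ℕ → ℝ) (L : ℕ) (f g k : X → ℝ) (l : ℕ) (ν : Measure X) : ℝ :=
  C4 γ L l * ((∫ t, f t ∂ν) * (∫ t, g t ∂ν) * ∫ t, k t ∂ν) +
    C5 γ L l * C3 γ L l * ((∫ t, f t * g t ∂ν) * (∫ t, k t ∂ν) +
      (∫ t, f t * k t ∂ν) * (∫ t, g t ∂ν) + (∫ t, g t * k t ∂ν) * (∫ t, f t ∂ν)) +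
    C6 γ L l * ∫ t, f t * g t * k t ∂ν

theorem measurable_integral_measure {f : X → ℝ} (hf : Measurable f) :
    Measurable fun ν : Measure X => ∫ t, f t ∂ν :=
  (hf.stronglyMeasurable.integral_kernel (κ := (⟨id, measurable_id⟩ : Kernel _ X))).measurable

variable {γ : ℕ → ℝ} {L : ℕ} {f g k : X → ℝ}

theorem measurable_momentFunctional2 (hf : Measurable f) (hg : Measurable g) (l : ℕ) :
    Measurable (momentFunctional2 γ L f g l) :=
  (((measurable_integral_measure hf).mul (measurable_integral_measure hg)).const_mul _).add
    ((measurable_integral_measure (hf.mul hg)).const_mul _)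

theorem measurable_momentFunctional3 (hf : Measurable f) (hg : Measurable g) (hk : Measurable k)
    (l : ℕ) : Measurable (momentFunctional3 γ L f g k l) := by
  have If := measurable_integral_measure hf
  have Ig := measurable_integral_measure hg
  have Ik := measurable_integral_measure hk
  exact ((((If.mul Ig).mul Ik).const_mul _).add
    (((((measurable_integral_measure (hf.mul hg)).mul Ik).add
      ((measurable_integral_measure (hf.mul hk)).mul Ig)).add
      ((measurable_integral_measure (hg.mul hk)).mul If)).const_mul _)).add
    ((measurable_integral_measure ((hf.mul hg).mul hk)).const_mul _)

end Functional

theorem abs_mul_le_one {x y : ℝ} (hx : |x| ≤ 1) (hy : |y| ≤ 1) : |x * y| ≤ 1 := by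
  rw [abs_mul]
  exact mul_le_one₀ hx (abs_nonneg _) hy

namespace CondDirichletProcess

variable {Ω Θ : Type*} [MeasurableSpace Θ] {m mΩ : MeasurableSpace Ω} {μ : Measure Ω}
  [IsFiniteMeasure μ] {c : ℝ} {G₀ G : Ω → Measure Θ} [∀ ω, IsProbabilityMeasure (G ω)]
  [∀ ω, IsProbabilityMeasure (G₀ ω)] {f g k : Θ → ℝ}

theorem hasCondExp_mul_mul (h : CondDirichletProcess μ m c G₀ G) (hm : m ≤ mΩ) (hc : 0 < c)
    (hG : Measurable G) (hf : Measurable f) (hg : Measurable g) (hk : Measurable k)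
    (hf1 : ∀ t, |f t| ≤ 1) (hg1 : ∀ t, |g t| ≤ 1) (hk1 : ∀ t, |k t| ≤ 1) :
    HasCondExp μ m (fun ω => (∫ t, f t ∂G ω) * (∫ t, g t ∂G ω) * ∫ t, k t ∂G ω)
      fun ω => dpMoment c (G₀ ω) f g k := by
  have hint : ∀ (ω : Ω) (s : Θ → ℝ), (∀ t, |s t| ≤ 1) → |∫ t, s t ∂G ω| ≤ 1 := fun ω s h1 => by
    simpa using norm_integral_le_of_norm_le_const (μ := G ω) (f := s) (C := 1) (ae_of_all _ h1)
  refine ⟨.of_bound (C := 1) ?_ (ae_of_all _ fun ω => ?_),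
    h.condExp_integral_mul_mul hm hc hG hf hg hk hf1 hg1 hk1⟩
  · exact ((((measurable_integral_measure hf).comp hG).mul
      ((measurable_integral_measure hg).comp hG)).mul
      ((measurable_integral_measure hk).comp hG)).aestronglyMeasurable
  · exact abs_mul_le_one (abs_mul_le_one (hint ω f hf1) (hint ω g hg1)) (hint ω k hk1)

/-- The case `k = 1` of the third moment, in which the factor `c + 2` cancels. -/
theorem hasCondExp_mul (h : CondDirichletProcess μ m c G₀ G) (hm : m ≤ mΩ) (hc : 0 < c)
    (hG : Measurable G) (hf : Measurable f) (hg : Measurable g)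
    (hf1 : ∀ t, |f t| ≤ 1) (hg1 : ∀ t, |g t| ≤ 1) :
    HasCondExp μ m (fun ω => (∫ t, f t ∂G ω) * ∫ t, g t ∂G ω)
      fun ω => (c * ((∫ t, f t ∂G₀ ω) * ∫ t, g t ∂G₀ ω) + ∫ t, f t * g t ∂G₀ ω) / (c + 1) := by
  have := h.hasCondExp_mul_mul hm hc hG hf hg measurable_one hf1 hg1 (by simp)
  simp only [dpMoment, Pi.one_apply, integral_const, probReal_univ, one_smul, mul_one] at this
  refine this.congr_right (ae_of_all _ fun ω => ?_)
  field_simp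
  ring

theorem hasCondExp_integral (h : CondDirichletProcess μ m c G₀ G) (hm : m ≤ mΩ) (hc : 0 < c)
    (hG : Measurable G) (hf : Measurable f) (hf1 : ∀ t, |f t| ≤ 1) :
    HasCondExp μ m (fun ω => ∫ t, f t ∂G ω) fun ω => ∫ t, f t ∂G₀ ω := by
  have := h.hasCondExp_mul hm hc hG hf measurable_one hf1 (by simp)
  simp only [Pi.one_apply, integral_const, probReal_univ, one_smul, mul_one] at this
  refine this.congr_right (ae_of_all _ fun ω => ?_)
  field_simp

variable {γ : ℕ → ℝ} {L l : ℕ}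

theorem hasCondExp_momentFunctional2 (hγ : ∀ l < L, 0 < γ l) (hl : l + 1 < L)
    (h : CondDirichletProcess μ m (γ (l + 1)) G₀ G) (hm : m ≤ mΩ)
    (hG : Measurable G) (hf : Measurable f) (hg : Measurable g)
    (hf1 : ∀ t, |f t| ≤ 1) (hg1 : ∀ t, |g t| ≤ 1) :
    HasCondExp μ m (fun ω => momentFunctional2 γ L f g (l + 1) (G ω))
      fun ω => momentFunctional2 γ L f g l (G₀ ω) := by
  have hc := hγ _ hl
  refine (((h.hasCondExp_mul hm hc hG hf hg hf1 hg1).const_mul (C2 γ L (l + 1))).add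
    ((h.hasCondExp_integral hm hc hG (hf.mul hg)
      fun t => abs_mul_le_one (hf1 t) (hg1 t)).const_mul (C3 γ L (l + 1)))).congr_right
    (ae_of_all _ fun ω => ?_)
  simp only [momentFunctional2, C2_step hl, C3_step hγ hl, Pi.mul_apply]
  field_simp
  ring

/-- The inductive step of the whole argument: third, second and first moments of the process are
inserted term by term, and the coefficients match by the three step formulas. -/
theorem hasCondExp_momentFunctional3 (hγ : ∀ l < L, 0 < γ l) (hl : l + 1 < L)
    (h : CondDirichletProcess μ m (γ (l + 1)) G₀ G) (hm : m ≤ mΩ)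
    (hG : Measurable G) (hf : Measurable f) (hg : Measurable g) (hk : Measurable k)
    (hf1 : ∀ t, |f t| ≤ 1) (hg1 : ∀ t, |g t| ≤ 1) (hk1 : ∀ t, |k t| ≤ 1) :
    HasCondExp μ m (fun ω => momentFunctional3 γ L f g k (l + 1) (G ω))
      fun ω => momentFunctional3 γ L f g k l (G₀ ω) := by
  have hc := hγ _ hl
  have hfg := fun t => abs_mul_le_one (hf1 t) (hg1 t)
  have hfk := fun t => abs_mul_le_one (hf1 t) (hk1 t)
  have hgk := fun t => abs_mul_le_one (hg1 t) (hk1 t)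
  have h3 := h.hasCondExp_mul_mul hm hc hG hf hg hk hf1 hg1 hk1
  have hfg_k := h.hasCondExp_mul hm hc hG (hf.mul hg) hk hfg hk1
  have hfk_g := h.hasCondExp_mul hm hc hG (hf.mul hk) hg hfk hg1
  have hgk_f := h.hasCondExp_mul hm hc hG (hg.mul hk) hf hgk hf1
  have hfgk := h.hasCondExp_integral hm hc hG ((hf.mul hg).mul hk)
    fun t => abs_mul_le_one (hfg t) (hk1 t)
  refine (((h3.const_mul (C4 γ L (l + 1))).add (((hfg_k.add hfk_g).add hgk_f).const_mul
    (C5 γ L (l + 1) * C3 γ L (l + 1)))).add (hfgk.const_mul (C6 γ L (l + 1)))).congr_right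
    (ae_of_all _ fun ω => ?_)
  have e1 : ∀ t, f t * k t * g t = f t * g t * k t := fun t => by ring
  have e2 : ∀ t, g t * k t * f t = f t * g t * k t := fun t => by ring
  simp only [momentFunctional3, dpMoment, C4_step hl, C5_mul_C3_step hγ hl, C6_step hγ hl,
    Pi.mul_apply, e1, e2]
  field_simp
  ring

end CondDirichletProcess

/-! ### The moments of the hierarchical Dirichlet process -/

section Moments

variable {Ω Θ V : Type*} [MeasurableSpace Θ] {mΩ : MeasurableSpace Ω} {μ : Measure Ω}
  {L d : ℕ} {T : LevelTree V L} {γ : ℕ → ℝ} {H : Measure Θ}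
  {F : Θ → Fin d → ℝ} {N : V → ℕ} {G : V → Ω → Measure Θ} {θ : V → ℕ → Ω → Θ}
  {x : V → ℕ → Ω → Fin d}

theorem measurable_of_comap_le {E : Type*} [MeasurableSpace E] {m : MeasurableSpace Ω} {Y : Ω → E}
    {f : E → ℝ} (hf : Measurable f) (h : MeasurableSpace.comap Y inferInstance ≤ m) :
    Measurable[m] fun ω => f (Y ω) :=
  (hf.comp (comap_measurable Y)).mono h le_rfl

namespace IsHDP

theorem measurable_F_apply (h : IsHDP μ T γ H F N G θ x) (a : Fin d) :
    Measurable fun t => F t a := (measurable_pi_apply a).comp h.measurable_F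

theorem abs_F_le_one (h : IsHDP μ T γ H F N G θ x) (t : Θ) (a : Fin d) : |F t a| ≤ 1 := by
  rw [abs_of_nonneg (h.F_nonneg t a), ← h.F_sum t]
  exact Finset.single_le_sum (fun b _ => h.F_nonneg t b) (Finset.mem_univ a)

theorem pastOfNode_le (h : IsHDP μ T γ H F N G θ x) (i : V) : pastOfNode T G i ≤ mΩ :=
  iSup₂_le fun k _ => (h.measurable_G k).comap_le

theorem pastOfTopic_le (h : IsHDP μ T γ H F N G θ x) (p : V × ℕ) :
    pastOfTopic T N G θ p ≤ mΩ :=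
  sup_le (iSup_le fun k => (h.measurable_G k).comap_le)
    (iSup₂_le fun q _ => (h.measurable_θ q.1 q.2).comap_le)

theorem pastOfWord_le (h : IsHDP μ T γ H F N G θ x) (p : V × ℕ) :
    pastOfWord T N G θ x p ≤ mΩ :=
  sup_le (sup_le (iSup_le fun k => (h.measurable_G k).comap_le)
    (iSup₂_le fun q _ => (h.measurable_θ q.1 q.2).comap_le))
    (iSup₂_le fun q _ => (h.measurable_x q.1 q.2).comap_le)

variable [IsProbabilityMeasure μ]

/-- The moments at a leaf. -/
theorem condExp_prod_oneHot (h : IsHDP μ T γ H F N G θ x) {i : V} (hi : T.IsLeaf i) {r : ℕ}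
    (hr : r ≤ N i) (a : Fin r → Fin d) :
    μ[fun ω => ∏ s : Fin r, oneHot (x i s ω) (a s) | MeasurableSpace.comap (G i) inferInstance]
      =ᵐ[μ] fun ω => ∏ s : Fin r, ∫ t, F t (a s) ∂G i ω := by
  have := h.isProbabilityMeasure_G
  have htok : ∀ s : Fin r, (i, (s : ℕ)) ∈ Token T N := fun s => ⟨hi, s.2.trans_le hr⟩
  have hne : ∀ s t : Fin r, s ≠ t → (i, (s : ℕ)) ∈ Token T N \ {(i, (t : ℕ))} := fun s t hst =>
    ⟨htok s, fun he => hst (Fin.ext (Prod.ext_iff.1 he).2)⟩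
  have hone : ∀ s : Fin r, Measurable fun w : Fin d => oneHot w (a s) := fun s =>
    measurable_of_finite _
  have hindicator : ∀ s : Fin r, (fun ω => oneHot (x i s ω) (a s)) =
      (x i s ⁻¹' {a s}).indicator fun _ => (1 : ℝ) := fun s => by
    funext ω
    simp [oneHot, Pi.single_apply, Set.indicator, eq_comm]
  have hint1 : ∀ (s : Fin r) ω, |∫ t, F t (a s) ∂G i ω| ≤ 1 := fun s ω => by
    simpa using norm_integral_le_of_norm_le_const (μ := G i ω) (f := fun t => F t (a s)) (C := 1)
      (ae_of_all _ fun t => h.abs_F_le_one t (a s))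
  have hGm : ∀ s : Fin r, Measurable[MeasurableSpace.comap (G i) inferInstance]
      fun ω => ∫ t, F t (a s) ∂G i ω := fun s =>
    measurable_of_comap_le (measurable_integral_measure (h.measurable_F_apply (a s))) le_rfl
  have hGw : ∀ p, MeasurableSpace.comap (G i) inferInstance ≤ pastOfWord T N G θ x p := fun p =>
    (le_iSup (fun k => MeasurableSpace.comap (G k) inferInstance) i).trans
      (le_sup_left.trans le_sup_left)
  have hGt : ∀ p, MeasurableSpace.comap (G i) inferInstance ≤ pastOfTopic T N G θ p := fun p =>
    (le_iSup (fun k => MeasurableSpace.comap (G k) inferInstance) i).trans le_sup_left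
  -- Words are replaced by their probabilities given the topics; afterwards the topics are
  -- integrated out against `G i`.
  have hw := condExp_prod_mul_congr (μ := μ) (m₀ := MeasurableSpace.comap (G i) inferInstance)
    (ℱ := fun s : Fin r => pastOfWord T N G θ x (i, s))
    (Y := fun s ω => oneHot (x i s ω) (a s)) (g := fun s ω => F (θ i s ω) (a s))
    (fun s => hGw _) (fun s => h.pastOfWord_le _)
    (fun s t hst => measurable_of_comap_le (hone s)
      (le_sup_of_le_right (le_iSup₂_of_le (i, (s : ℕ)) (hne s t hst) le_rfl)))
    (fun s t => measurable_of_comap_le (h.measurable_F_apply (a s))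
      (le_sup_of_le_left (le_sup_of_le_right (le_iSup₂_of_le (i, (s : ℕ)) (htok s) le_rfl))))
    (fun s => (hone s).comp (h.measurable_x i s))
    (fun s ω => by
      simp only [oneHot, Pi.single_apply]
      split_ifs <;> simp)
    (fun s ω => h.abs_F_le_one _ _)
    (fun s => by
      rw [hindicator]
      exact h.law_word i s (htok s) (a s))
    Finset.univ (Z := 1)
    (fun s => @measurable_const ℝ Ω _ (pastOfWord T N G θ x (i, s)) 1) measurable_one (by simp)
  have ht := condExp_prod_mul_congr (μ := μ) (m₀ := MeasurableSpace.comap (G i) inferInstance)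
    (ℱ := fun s : Fin r => pastOfTopic T N G θ (i, s))
    (Y := fun s ω => F (θ i s ω) (a s)) (g := fun s ω => ∫ t, F t (a s) ∂G i ω)
    (fun s => hGt _) (fun s => h.pastOfTopic_le _)
    (fun s t hst => measurable_of_comap_le (h.measurable_F_apply (a s))
      (le_sup_of_le_right (le_iSup₂_of_le (i, (s : ℕ)) (hne s t hst) le_rfl)))
    (fun s t => (hGm s).mono (hGt _) le_rfl)
    (fun s => (h.measurable_F_apply (a s)).comp (h.measurable_θ i s))
    (fun s ω => h.abs_F_le_one _ _)
    hint1
    (fun s => condExp_comp_of_condLaw (h.pastOfTopic_le _) (h.measurable_θ i s)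
      (h.law_topic i s (htok s)) (h.measurable_F_apply (a s)) fun t => h.abs_F_le_one t (a s))
    Finset.univ (Z := 1)
    (fun s => @measurable_const ℝ Ω _ (pastOfTopic T N G θ (i, s)) 1) measurable_one (by simp)
  simp only [one_mul, Finset.prod_fn] at hw ht
  refine (hw.trans ht).trans ?_
  -- The product of integrals depends on `G i` only, so the conditioning acts trivially.
  rw [condExp_of_stronglyMeasurable (h.measurable_G i).comap_le]
  · exact (Finset.measurable_prod _ fun s _ => hGm s).stronglyMeasurable
  · refine .of_bound (C := 1) ((Finset.measurable_prod _ fun s _ => hGm s).mono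
      (h.measurable_G i).comap_le le_rfl).aestronglyMeasurable (ae_of_all _ fun ω => ?_)
    rw [Real.norm_eq_abs, Finset.abs_prod]
    exact Finset.prod_le_one (fun _ _ => abs_nonneg _) fun s _ => hint1 s ω

variable [Fintype V] [DecidableEq V]

/-- The moments are computed by functionals `K l` of the node distributions if these agree with
the moments at the leaves and are compatible with the conditional expectations of the children. -/
theorem moment_ae_eq (h : IsHDP μ T γ H F N G θ x) {r : ℕ} (a : Fin r → Fin d)
    {K : ℕ → Measure Θ → ℝ} (hK : ∀ l, Measurable (K l))
    (hleaf : ∀ i, T.IsLeaf i → μ[fun ω => ∏ s : Fin r, oneHot (x i s ω) (a s) |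
      MeasurableSpace.comap (G i) inferInstance] =ᵐ[μ] fun ω => K (L - 1) (G i ω))
    (hstep : ∀ i, i ≠ T.root → ∀ l, T.level i = l + 1 → HasCondExp μ (pastOfNode T G i)
      (fun ω => K (l + 1) (G i ω)) fun ω => K l (G (T.parent i) ω)) (i : V) :
    (fun ω => moment μ T G x r i ω a) =ᵐ[μ] fun ω => K (T.level i) (G i ω) := by
  have main : ∀ n i, T.level i + n = L - 1 →
      (fun ω => momentAtHeight μ T G x r n i ω a) =ᵐ[μ] fun ω => K (T.level i) (G i ω) := by
    intro n
    induction n with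
    | zero =>
      intro i hi
      have hlt := T.level_lt i
      have h1 := hleaf i (show T.level i + 1 = L by omega)
      rw [← hi] at h1
      exact h1
    | succ n ih =>
      intro i hi
      have hlt := T.level_lt i
      have hchild : ∀ j ∈ T.children i, HasCondExp μ (MeasurableSpace.comap (G i) inferInstance)
          (fun ω => momentAtHeight μ T G x r n j ω a) fun ω => K (T.level i) (G i ω) := by
        intro j hj
        obtain ⟨hroot, rfl⟩ := (Finset.mem_filter.1 hj).2
        have hlev := T.level_parent j hroot
        have hne : T.parent j ≠ j := fun he => by rw [he] at hlev; omega
        have h1 := hstep j hroot _ hlev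
        rw [← hlev] at h1
        -- The parent lies one level above `j` and differs from it, so its distribution belongs to
        -- the past of `j`.
        refine HasCondExp.of_le (h1.congr_left (ih j (by omega))) ?_ (h.pastOfNode_le j)
          (measurable_of_comap_le (hK _) le_rfl)
        exact le_iSup₂_of_le (T.parent j) ⟨hne, by omega⟩ le_rfl
      obtain ⟨w, hw, hwi⟩ := T.exists_child i (by omega)
      have hcard : ((T.children i).card : ℝ) ≠ 0 :=
        Nat.cast_ne_zero.2 (Finset.card_ne_zero.2 ⟨w, by simp [LevelTree.children, hw, hwi]⟩)
      refine ((HasCondExp.sum hchild).const_mul _).2.trans (ae_of_all _ fun ω => ?_)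
      simp only [Finset.sum_const, nsmul_eq_mul]
      field_simp
  have hlt := T.level_lt i
  exact main _ i (by omega)

theorem moment_one_ae_eq (h : IsHDP μ T γ H F N G θ x) (hγ : ∀ l < L, 0 < γ l)
    (hN : ∀ i, T.IsLeaf i → 3 ≤ N i) (i : V) (a : Fin 1 → Fin d) :
    (fun ω => moment μ T G x 1 i ω a) =ᵐ[μ] fun ω => ∫ t, F t (a 0) ∂G i ω := by
  have := h.isProbabilityMeasure_G
  refine h.moment_ae_eq a (K := fun _ ν => ∫ t, F t (a 0) ∂ν)
    (fun _ => measurable_integral_measure (h.measurable_F_apply _)) (fun j hj => ?_)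
    (fun j hj l hl => ?_) i
  · simpa using h.condExp_prod_oneHot hj (by have := hN j hj; omega) a
  · exact (h.law_node j hj).hasCondExp_integral (h.pastOfNode_le j) (hγ _ (T.level_lt j))
      (h.measurable_G j) (h.measurable_F_apply _) fun t => h.abs_F_le_one t _

theorem moment_two_ae_eq (h : IsHDP μ T γ H F N G θ x) (hγ : ∀ l < L, 0 < γ l)
    (hN : ∀ i, T.IsLeaf i → 3 ≤ N i) (i : V) (a : Fin 2 → Fin d) :
    (fun ω => moment μ T G x 2 i ω a) =ᵐ[μ] fun ω =>
      momentFunctional2 γ L (fun t => F t (a 0)) (fun t => F t (a 1)) (T.level i) (G i ω) := by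
  have := h.isProbabilityMeasure_G
  refine h.moment_ae_eq a (K := momentFunctional2 γ L (fun t => F t (a 0)) fun t => F t (a 1))
    (fun _ => measurable_momentFunctional2 (h.measurable_F_apply _)
    (h.measurable_F_apply _) _) (fun j hj => ?_) (fun j hj l hl => ?_) i
  · have hL : ¬L - 1 + 1 < L := by omega
    simpa [momentFunctional2, C2_bottom hL, C3_bottom hL, Fin.prod_univ_two] using
      h.condExp_prod_oneHot hj (by have := hN j hj; omega) a
  · have hlaw := h.law_node j hj
    rw [hl] at hlaw
    exact hlaw.hasCondExp_momentFunctional2 hγ (hl ▸ T.level_lt j) (h.pastOfNode_le j)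
      (h.measurable_G j) (h.measurable_F_apply _) (h.measurable_F_apply _)
      (fun t => h.abs_F_le_one t _) fun t => h.abs_F_le_one t _

theorem moment_three_ae_eq (h : IsHDP μ T γ H F N G θ x) (hγ : ∀ l < L, 0 < γ l)
    (hN : ∀ i, T.IsLeaf i → 3 ≤ N i) (i : V) (a : Fin 3 → Fin d) :
    (fun ω => moment μ T G x 3 i ω a) =ᵐ[μ] fun ω =>
      momentFunctional3 γ L (fun t => F t (a 0)) (fun t => F t (a 1)) (fun t => F t (a 2))
        (T.level i) (G i ω) := by
  have := h.isProbabilityMeasure_G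
  refine h.moment_ae_eq a
    (K := momentFunctional3 γ L (fun t => F t (a 0)) (fun t => F t (a 1)) fun t => F t (a 2))
    (fun _ => measurable_momentFunctional3 (h.measurable_F_apply _)
    (h.measurable_F_apply _) (h.measurable_F_apply _) _) (fun j hj => ?_)
    (fun j hj l hl => ?_) i
  · have hL : ¬L - 1 + 1 < L := by omega
    simpa [momentFunctional3, C4_bottom hL, C3_bottom hL, C6_bottom hL, Fin.prod_univ_three] using
      h.condExp_prod_oneHot hj (by have := hN j hj; omega) a
  · have hlaw := h.law_node j hj
    rw [hl] at hlaw
    exact hlaw.hasCondExp_momentFunctional3 hγ (hl ▸ T.level_lt j) (h.pastOfNode_le j)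
      (h.measurable_G j) (h.measurable_F_apply _) (h.measurable_F_apply _)
      (h.measurable_F_apply _) (fun t => h.abs_F_le_one t _) (fun t => h.abs_F_le_one t _)
      fun t => h.abs_F_le_one t _

end IsHDP

/-! ### The symmetric tensors -/

/-- Only constant multi-indices contribute, so the sum runs over the diagonal copy of `κ`;
summability plays no role. -/
theorem tensorMap_smul_diagTensor {κ ι : Type*} [DecidableEq κ] (c : ℝ) (r : ℕ) (w : κ → ℝ)
    (Φ : Matrix ι κ ℝ) (a : Fin (r + 1) → ι) :
    tensorMap (c • diagTensor r w) Φ a = c * ∑' v, w v * ∏ s, Φ (a s) v := by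
  have hinj : Function.Injective fun (v : κ) (_ : Fin (r + 1)) => v :=
    fun v w h => congrFun h 0
  have hsupp : Function.support (fun j : Fin (r + 1) → κ =>
      (c • diagTensor r w) j * ∏ s, Φ (a s) (j s)) ⊆
      Set.range fun (v : κ) (_ : Fin (r + 1)) => v := by
    intro j hj
    by_contra hn
    refine hj ?_
    have : ¬∀ s, j s = j 0 := fun hall => hn ⟨j 0, funext fun s => (hall s).symm⟩
    simp [diagTensor, this]
  rw [tensorMap, ← hinj.tsum_eq hsupp, ← tsum_mul_left]
  refine tsum_congr fun v => ?_
  simp [diagTensor, mul_assoc]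

theorem integral_eq_tsum_of_eq_sum_dirac {κ : Type*} [Countable κ] {ν : Measure Θ}
    [IsFiniteMeasure ν] {w : κ → ℝ} (hw : ∀ v, 0 ≤ w v) {φ : κ → Θ}
    (hν : ν = Measure.sum fun v => ENNReal.ofReal (w v) • Measure.dirac (φ v)) {f : Θ → ℝ}
    (hf : Measurable f) {C : ℝ} (hC : ∀ t, |f t| ≤ C) : ∫ t, f t ∂ν = ∑' v, w v * f (φ v) := by
  have hint : Integrable f ν := .of_bound hf.aestronglyMeasurable C (ae_of_all _ hC)
  rw [hν] at hint ⊢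
  rw [integral_sum_measure hint]
  refine tsum_congr fun v => ?_
  -- Measurability of `f` is used here in place of measurable singletons in `Θ`.
  rw [integral_smul_measure, integral_dirac' _ _ hf.stronglyMeasurable,
    ENNReal.toReal_ofReal (hw v), smul_eq_mul]

/-- A single null set serves all orders, constants and entries, since it is the one excluded by the
stick-breaking form. -/
theorem tensorMap_topicMatrix {κ : Type*} [Countable κ] [DecidableEq κ]
    (h : IsHDP μ T γ H F N G θ x) {π : V → Ω → κ → ℝ} {φ : Ω → κ → Θ}
    (hπ : IsStickBreaking μ G π φ) (i : V) :
    ∀ᵐ ω ∂μ, ∀ (c : ℝ) (r : ℕ) (a : Fin (r + 1) → Fin d),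
      tensorMap (c • diagTensor r (π i ω)) (topicMatrix F (φ ω)) a =
        c * ∫ t, ∏ s, F t (a s) ∂G i ω := by
  filter_upwards [hπ.2 i] with ω hω c r a
  have := h.isProbabilityMeasure_G i ω
  rw [tensorMap_smul_diagTensor, integral_eq_tsum_of_eq_sum_dirac (hπ.1 i ω) hω
    (Finset.measurable_prod _ fun s _ => h.measurable_F_apply (a s)) (C := 1) fun t => ?_]
  · rfl
  · rw [Finset.abs_prod]
    exact Finset.prod_le_one (fun _ _ => abs_nonneg _) fun s _ => h.abs_F_le_one t _

variable [IsProbabilityMeasure μ] [Fintype V] [DecidableEq V]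

theorem symmetricTensors_ae_eq {κ : Type*} [Countable κ] [DecidableEq κ]
    (hγ : ∀ l < L, 0 < γ l) (hN : ∀ i, T.IsLeaf i → 3 ≤ N i)
    (h : IsHDP μ T γ H F N G θ x) {π : V → Ω → κ → ℝ} {φ : Ω → κ → Θ}
    (hπ : IsStickBreaking μ G π φ) (i : V) : ∀ᵐ ω ∂μ,
      S1 μ T G x i ω = tensorMap (diagTensor 0 (π i ω)) (topicMatrix F (φ ω)) ∧
      S2 μ T γ G x i ω =
        tensorMap (C3 γ L (T.level i) • diagTensor 1 (π i ω)) (topicMatrix F (φ ω)) ∧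
      S3 μ T γ G x i ω =
        tensorMap (C6 γ L (T.level i) • diagTensor 2 (π i ω)) (topicMatrix F (φ ω)) := by
  filter_upwards [tensorMap_topicMatrix h hπ i,
    ae_all_iff.2 fun a => h.moment_one_ae_eq hγ hN i a,
    ae_all_iff.2 fun a => h.moment_two_ae_eq hγ hN i a,
    ae_all_iff.2 fun a => h.moment_three_ae_eq hγ hN i a] with ω ht h1 h2 h3
  -- Because `S2` already carries `C3`, subtracting `C5` times its symmetrisation removes precisely
  -- the `C5 * C3` terms of the third moment.
  have hS2 : ∀ a, S2 μ T γ G x i ω a =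
      C3 γ L (T.level i) * ∫ t, F t (a 0) * F t (a 1) ∂G i ω := by
    intro a
    simp [S2, S1, outer, h1, h2, momentFunctional2]
  refine ⟨funext fun a => ?_, funext fun a => ?_, funext fun a => ?_⟩
  · rw [← one_smul ℝ (diagTensor 0 (π i ω)), ht, S1, h1]
    simp
  · rw [ht, hS2]
    simp [Fin.prod_univ_two]
  · have hcomm : ∀ t, F t (a 2) * F t (a 0) = F t (a 0) * F t (a 2) := fun t => mul_comm _ _
    rw [ht]
    simp [S3, S1, outer, sym3, hS2, h1, h3, momentFunctional3, Fin.prod_univ_three, hcomm]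
    ring

end Moments

end HDP

end

theorem mainTheorem1 {Ω Θ V κ : Type*} [MeasurableSpace Ω] [MeasurableSpace Θ]
    [Fintype V] [DecidableEq V] [Countable κ] [DecidableEq κ]
    (μ : Measure Ω) [IsProbabilityMeasure μ] (L d : ℕ) (T : HDP.LevelTree V L)
    (γ : ℕ → ℝ) (hγ : ∀ l < L, 0 < γ l) (H : Measure Θ) [IsProbabilityMeasure H]
    (F : Θ → Fin d → ℝ) (N : V → ℕ) (hN : ∀ i, T.IsLeaf i → 3 ≤ N i)
    (G : V → Ω → Measure Θ) (θ : V → ℕ → Ω → Θ) (x : V → ℕ → Ω → Fin d)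
    (hHDP : HDP.IsHDP μ T γ H F N G θ x)
    (π : V → Ω → κ → ℝ) (φ : Ω → κ → Θ) (hπ : HDP.IsStickBreaking μ G π φ) :
    -- the symmetric tensors at every vertex
    (∀ i : V, ∀ᵐ ω ∂μ,
      HDP.S1 μ T G x i ω =
        HDP.tensorMap (HDP.diagTensor 0 (π i ω)) (HDP.topicMatrix F (φ ω)) ∧
      HDP.S2 μ T γ G x i ω =
        HDP.tensorMap (HDP.C3 γ L (T.level i) • HDP.diagTensor 1 (π i ω))
          (HDP.topicMatrix F (φ ω)) ∧
      HDP.S3 μ T γ G x i ω =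
        HDP.tensorMap (HDP.C6 γ L (T.level i) • HDP.diagTensor 2 (π i ω))
          (HDP.topicMatrix F (φ ω))) ∧
    -- the denominators of the recursion do not vanish
    (∀ l, l + 1 < L → 0 < HDP.C3 γ L l) ∧
    -- the coefficients at the root in closed form
    HDP.C2 γ L 0 =
      (∏ i ∈ Finset.Icc 1 (L - 1), γ i) / ∏ i ∈ Finset.Icc 1 (L - 1), (γ i + 1) ∧
    HDP.C3 γ L 0 =
      ∑ i ∈ Finset.Icc 1 (L - 1),
        (∏ j ∈ Finset.Icc 1 (i - 1), γ (L - j)) / ∏ j ∈ Finset.Icc 1 i, (γ (L - j) + 1) ∧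
    HDP.C4 γ L 0 =
      (∏ i ∈ Finset.Icc 1 (L - 1), γ i ^ 2) /
        ∏ i ∈ Finset.Icc 1 (L - 1), ((γ i + 1) * (γ i + 2)) ∧
    (2 ≤ L → HDP.C5 γ L 0 =
      (∑ i ∈ Finset.Icc 1 (L - 1),
        ((∏ j ∈ Finset.Icc 1 (i - 1), γ (L - j)) * ∏ j ∈ Finset.Icc 1 (L - 1), γ j) /
          ((∏ j ∈ Finset.Icc 1 i, (γ (L - j) + 2)) *
            ∏ j ∈ Finset.Icc 1 (L - 1), (γ j + 1))) / HDP.C3 γ L 0) ∧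
    HDP.C6 γ L 0 =
      3 * ∑ i ∈ Finset.Icc 1 (L - 2), ∑ j ∈ Finset.Icc (i + 1) (L - 1),
        ((∏ k ∈ Finset.Icc 1 (i - 1), γ (L - k)) * ∏ k ∈ Finset.Icc 1 (j - 1), γ (L - k)) /
          ((∏ k ∈ Finset.Icc 1 i, (γ (L - k) + 2)) *
            ∏ k ∈ Finset.Icc 1 j, (γ (L - k) + 1)) +
      2 * ∑ i ∈ Finset.Icc 1 (L - 1),
        (∏ j ∈ Finset.Icc 1 (i - 1), γ (L - j) ^ 2) /
          ∏ j ∈ Finset.Icc 1 i, ((γ (L - j) + 1) * (γ (L - j) + 2)) := by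
  refine ⟨fun i => HDP.symmetricTensors_ae_eq hγ hN hHDP hπ i, fun l hl => HDP.C3_pos hγ hl,
    ?_, ?_, ?_, fun hL2 => ?_, ?_⟩
  · have h := HDP.C2_eq_prod (γ := γ) (le_refl (L - 1))
    rw [Nat.sub_self] at h
    rw [h, HDP.prod_Icc_reflect fun i => γ i / (γ i + 1), Finset.prod_div_distrib]
  · have h := HDP.C3_eq_sum hγ (le_refl (L - 1))
    rwa [Nat.sub_self] at h
  · have h := HDP.C4_eq_prod (γ := γ) (le_refl (L - 1))
    rw [Nat.sub_self] at h
    rw [h, HDP.prod_Icc_reflect fun i => γ i ^ 2 / ((γ i + 1) * (γ i + 2)),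
      Finset.prod_div_distrib]
  · have h := HDP.C5_mul_C3_eq_sum hγ (le_refl (L - 1))
    rw [Nat.sub_self, HDP.prod_Icc_reflect fun i => γ i / (γ i + 1), Finset.prod_div_distrib] at h
    -- Two levels are needed: for `L = 1` the root is a leaf and `C3` vanishes.
    have h3 : HDP.C3 γ L 0 ≠ 0 := (HDP.C3_pos hγ (by omega)).ne'
    rw [eq_div_iff h3, h, Finset.sum_mul]
    exact Finset.sum_congr rfl fun i _ => div_mul_div_comm _ _ _ _
  · have h := HDP.C6_eq_sum hγ (le_refl (L - 1))
    rw [Nat.sub_self, HDP.sum_Icc_lt_comm fun i j =>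
      ((∏ k ∈ Finset.Icc 1 (i - 1), γ (L - k)) * ∏ k ∈ Finset.Icc 1 (j - 1), γ (L - k)) /
        ((∏ k ∈ Finset.Icc 1 i, (γ (L - k) + 2)) * ∏ k ∈ Finset.Icc 1 j, (γ (L - k) + 1))] at h
    exact h
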